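/- Setting. Let $\Omega$ be a Polish space, $\mathbb P$ a Borel probability measure on $\Omega$, and $\mathcal F$ the $\mathbb P$-completion of the Borel $\sigma$-algebra; $\mathbb R\times\Omega$ carries $\mathcal B(\mathbb R)\otimes\mathcal F$. Let $(\tau_x)_{x\in\mathbb R}$ be transformations of $\Omega$ with $\tau_0=\mathrm{id}$ and $\tau_{x+y}=\tau_x\circ\tau_y$ such that $(x,\omega)\mapsto\tau_x\omega$ is measurable from $\mathbb R\times\Omega$ to $\Omega$ with its Borel sets, $\mathbb P(\tau_x(E))=\mathbb P(E)$ for all $E\in\mathcal F$ and $x\in\mathbb R$, and the action is ergodic: every measurable $\varphi:\Omega\to\mathbb R$ with $\mathbb P(\varphi(\tau_x\omega)=\varphi(\omega))=1$ for every $x$ is almost surely constant. A jointly measurable $f:\mathbb R\times\Omega\to\mathbb R$ is called stationary if $f(x+y,\omega)=f(x,\tau_y\omega)$ for all $x,y,\omega$. Let $a:\mathbb R\times\Omega\to[0,1]$ be stationary, with $a(\cdot,\omega)>0$ on $\mathbb R$ for almost every $\omega$, and, for some constant $\kappa>0$, with $\sqrt{a(\cdot,\omega)}$ $\kappa$-Lipschitz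 for every $\omega$. Let $\alpha_0,\alpha_1>0$, $\gamma>2$, and let $H:\mathbb R\times\mathbb R\times\Omega\to\mathbb R$ be jointly measurable with $H(x+y,p,\omega)=H(x,p,\tau_y\omega)$ and, for all $x,y,p,q\in\mathbb R$ and $\omega\in\Omega$, $$\alpha_0|p|^\gamma-\tfrac1{\alpha_0}\le H(x,p,\omega)\le\alpha_1(|p|^\gamma+1),$$ $$|H(x,p,\omega)-H(x,q,\omega)|\le\alpha_1(|p|+|q|+1)^{\gamma-1}|p-q|,$$ $$|H(x,p,\omega)-H(y,p,\omega)|\le\alpha_1(|p|^\gamma+1)|x-y|.$$ For $\omega\in\Omega$ let $\lambda_0(\omega)$ be the infimum of all $\lambda\in\mathbb R$ for which $a(x,\omega)u''+H(x,u',\omega)=\lambda$ has a continuous viscosity supersolution $u$ on $\mathbb R$, that is, $a(x_0,\omega)\varphi''(x_0)+H(x_0,\varphi'(x_0),\omega)\le\lambda$ whenever $\varphi\in C^2(\mathbb R)$ and $u-\varphi$ has a local minimum at $x_0$. For $\lambda\in\mathbb R$ let $\mathcal S_\lambda(\omega)$ be the set of all $f\in C^1(\mathbb R)$ with $a(x,\omega)f'(x)+H(x,f(x),\omega)=\lambda$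 for all $x\in\mathbb R$, and put $$\underline f_\lambda(x,\omega)=\inf_{f\in\mathcal S_\lambda(\omega)}f(x),\qquad \overline f_\lambda(x,\omega)=\sup_{f\in\mathcal S_\lambda(\omega)}f(x),$$ both being $0$ by convention if $\mathcal S_\lambda(\omega)=\emptyset$. Lemma. The function $\omega\mapsto\lambda_0(\omega)$ is almost surely equal to a constant $\lambda_0\in\mathbb R$. For every $\lambda\ge\lambda_0$ the functions $\underline f_\lambda,\overline f_\lambda:\mathbb R\times\Omega\to\mathbb R$ are jointly measurable and stationary. Moreover, for every $\omega$ with $a(\cdot,\omega)>0$ on $\mathbb R$ and $\lambda_0(\omega)\le\lambda$, the functions $\underline f_\lambda(\cdot,\omega)$ and $\overline f_\lambda(\cdot,\omega)$ belong to $\mathcal S_\lambda(\omega)$, so that they are its smallest and its largest element for the pointwise order; in particular this holds for almost every $\omega\in\Omega$. -/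

import Mathlib

open MeasureTheory

/-- The `σ`-algebra of `Ω` is the `P`-completion of the Borel `σ`-algebra of the topology of `Ω`.
(This includes the case in which it is the Borel `σ`-algebra itself and `P` is complete on it.) -/
structure IsCompletedBorel {Ω : Type*} [TopologicalSpace Ω] [MeasurableSpace Ω]
    (P : Measure Ω) : Prop where
  borel_le : ∀ E : Set Ω, MeasurableSet[borel Ω] E → MeasurableSet E
  complete : P.IsComplete
  ae_borel : ∀ E : Set Ω, MeasurableSet E → ∃ B : Set Ω, MeasurableSet[borel Ω] B ∧ E =ᵐ[P] B

/-- `τ` is a measurable one-parameter group of transformations of `Ω` which preserves `P`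
and whose action is ergodic. Joint measurability is with respect to the Borel sets of the
target, since typical flows are not measurable into the completed `σ`-algebra. -/
structure IsErgodicFlow {Ω : Type*} [TopologicalSpace Ω] [MeasurableSpace Ω]
    (P : Measure Ω) (τ : ℝ → Ω → Ω) : Prop where
  measurable : ∀ B : Set Ω, MeasurableSet[borel Ω] B →
    MeasurableSet {q : ℝ × Ω | τ q.1 q.2 ∈ B}
  zero : ∀ ω, τ 0 ω = ω
  add : ∀ x y ω, τ (x + y) ω = τ x (τ y ω)
  measure_image : ∀ (x : ℝ) (E : Set Ω), MeasurableSet E → P (τ x '' E) = P E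
  ergodic : ∀ φ : Ω → ℝ, Measurable φ → (∀ x, ∀ᵐ ω ∂P, φ (τ x ω) = φ ω) →
    ∃ c : ℝ, ∀ᵐ ω ∂P, φ ω = c

/-- Jointly measurable functions on `ℝ × Ω` that are stationary with respect to `τ`. -/
structure IsStationaryFun {Ω : Type*} [MeasurableSpace Ω] (τ : ℝ → Ω → Ω)
    (f : ℝ → Ω → ℝ) : Prop where
  measurable : Measurable (fun q : ℝ × Ω => f q.1 q.2)
  shift : ∀ x y ω, f (x + y) ω = f x (τ y ω)

/-- The standing assumptions on the diffusion coefficient. -/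
structure IsDiffusion {Ω : Type*} [MeasurableSpace Ω] (P : Measure Ω) (τ : ℝ → Ω → Ω)
    (κ : ℝ) (a : ℝ → Ω → ℝ) : Prop where
  stationary : IsStationaryFun τ a
  mem_Icc : ∀ x ω, a x ω ∈ Set.Icc (0 : ℝ) 1
  pos : ∀ᵐ ω ∂P, ∀ x, 0 < a x ω
  sqrt_lipschitz : ∀ ω x y, |√(a x ω) - √(a y ω)| ≤ κ * |x - y|

/-- Stationary Hamiltonians `H(x, p, ω)` in the class `ℋ(α₀, α₁, γ)`. -/
structure IsHamiltonian {Ω : Type*} [MeasurableSpace Ω] (τ : ℝ → Ω → Ω)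
    (α₀ α₁ γ : ℝ) (H : ℝ → ℝ → Ω → ℝ) : Prop where
  measurable : Measurable (fun q : ℝ × ℝ × Ω => H q.1 q.2.1 q.2.2)
  shift : ∀ x y p ω, H (x + y) p ω = H x p (τ y ω)
  lower : ∀ x p ω, α₀ * |p| ^ γ - 1 / α₀ ≤ H x p ω
  upper : ∀ x p ω, H x p ω ≤ α₁ * (|p| ^ γ + 1)
  lipschitz_p : ∀ x p q ω, |H x p ω - H x q ω| ≤ α₁ * (|p| + |q| + 1) ^ (γ - 1) * |p - q|
  lipschitz_x : ∀ x y p ω, |H x p ω - H y p ω| ≤ α₁ * (|p| ^ γ + 1) * |x - y|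

/-- `u` is a continuous viscosity supersolution of `a(x) u'' + H(x, u') = lam` in `ℝ`. -/
def IsViscositySupersolution (a : ℝ → ℝ) (H : ℝ → ℝ → ℝ) (lam : ℝ) (u : ℝ → ℝ) : Prop :=
  Continuous u ∧ ∀ (φ : ℝ → ℝ) (x₀ : ℝ), ContDiff ℝ 2 φ →
    IsLocalMin (fun x => u x - φ x) x₀ →
      a x₀ * deriv (deriv φ) x₀ + H x₀ (deriv φ x₀) ≤ lam

/-- The critical value: the infimum of all `lam` for which `a(x) u'' + H(x, u') = lam` has a
continuous viscosity supersolution in `ℝ`. -/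
noncomputable def criticalValue (a : ℝ → ℝ) (H : ℝ → ℝ → ℝ) : ℝ :=
  sInf {lam : ℝ | ∃ u : ℝ → ℝ, IsViscositySupersolution a H lam u}

/-- The set of all `C¹` solutions `f` of `a(x) f' + H(x, f) = lam` in `ℝ`. -/
def odeSolutions (a : ℝ → ℝ) (H : ℝ → ℝ → ℝ) (lam : ℝ) : Set (ℝ → ℝ) :=
  {f | ContDiff ℝ 1 f ∧ ∀ x, a x * deriv f x + H x (f x) = lam}

/-- The pointwise infimum, for fixed `ω`, of all `C¹` solutions; it is `0` if there are none
(`sInf ∅ = 0` in `ℝ`). -/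
noncomputable def lowerSolution {Ω : Type*} (a : ℝ → Ω → ℝ) (H : ℝ → ℝ → Ω → ℝ) (lam : ℝ)
    (x : ℝ) (ω : Ω) : ℝ :=
  sInf ((fun f : ℝ → ℝ => f x) '' odeSolutions (fun y => a y ω) (fun y p => H y p ω) lam)

/-- The pointwise supremum, for fixed `ω`, of all `C¹` solutions; it is `0` if there are none
(`sSup ∅ = 0` in `ℝ`). -/
noncomputable def upperSolution {Ω : Type*} (a : ℝ → Ω → ℝ) (H : ℝ → ℝ → Ω → ℝ) (lam : ℝ)
    (x : ℝ) (ω : Ω) : ℝ :=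
  sSup ((fun f : ℝ → ℝ => f x) '' odeSolutions (fun y => a y ω) (fun y p => H y p ω) lam)

/-! Fix `ω` with `a > 0`. As `γ > 2` and `a ≤ 1`, a solution larger in modulus than a constant `C`
depending on the level satisfies `f' ≤ -f ^ 2` and would blow up within unit distance. So every
solution is bounded by `C`, independently of any positive lower bound for `a` (`abs_le_of_eq`).
Given this bound, `a > 0` makes the equation locally Lipschitz: solutions do not cross (`le_of_le`),
and approximate solutions on growing intervals have exact solutions as limits
(`exists_mem_of_approx`).

If level `mu < lam` has a supersolution `u`, a solution at level `lam` started high at the left end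
of a bounded interval cannot fall too low, since its primitive would then touch `u` from below
(`exists_bounded_solution_on`). Compactness gives `criticalValue_le_iff`: solutions exist exactly at
the levels from the critical value on. It also makes the supremum and infimum at one point attained,
and non-crossing spreads extremality to all points.

For measurability, the existence of a solution with a one-sided bound at a point is tested on
countably many approximate solutions (`exists_mem_iff_approx`); semicontinuity in `x` yields joint
measurability. Translation carries solutions to solutions for every `ω`, so stationarity is exact
and ergodicity makes the invariant critical value constant. -/

open Set Filter Topology

/-! ### Primitives of continuous functions -/

/-- The primitive of `d` with value `r` at `c`. -/
noncomputable def primitive (c : ℝ) (d : ℝ → ℝ) (r x : ℝ) : ℝ := r + ∫ t in c..x, d t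

lemma hasDerivAt_primitive {d : ℝ → ℝ} (hd : Continuous d) (c r x : ℝ) :
    HasDerivAt (primitive c d r) (d x) x :=
  (intervalIntegral.integral_hasDerivAt_right (hd.intervalIntegrable _ _)
    (hd.stronglyMeasurableAtFilter _ _) hd.continuousAt).const_add r

lemma deriv_primitive {d : ℝ → ℝ} (hd : Continuous d) (c r : ℝ) :
    deriv (primitive c d r) = d :=
  funext fun x => (hasDerivAt_primitive hd c r x).deriv

lemma differentiable_primitive {d : ℝ → ℝ} (hd : Continuous d) (c r : ℝ) :
    Differentiable ℝ (primitive c d r) :=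
  fun x => (hasDerivAt_primitive hd c r x).differentiableAt

lemma contDiff_one_primitive {d : ℝ → ℝ} (hd : Continuous d) (c r : ℝ) :
    ContDiff ℝ 1 (primitive c d r) := by
  rw [contDiff_one_iff_deriv, deriv_primitive hd]
  exact ⟨differentiable_primitive hd c r, hd⟩

lemma contDiff_two_primitive {d : ℝ → ℝ} (hd : ContDiff ℝ 1 d) (c r : ℝ) :
    ContDiff ℝ 2 (primitive c d r) := by
  rw [show (2 : WithTop ℕ∞) = 1 + 1 from (one_add_one_eq_two).symm, contDiff_succ_iff_deriv,
    deriv_primitive hd.continuous]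
  exact ⟨differentiable_primitive hd.continuous c r, by simp, hd⟩

lemma primitive_self (c : ℝ) (d : ℝ → ℝ) (r : ℝ) : primitive c d r c = r := by
  simp [primitive]

/-! ### Riccati blow-up -/

/-- A function whose derivative is at most `-f ^ 2` wherever it exceeds `C ≥ 1` on an interval
of length one cannot exceed `C` at the right end point, as it would blow up to the left. -/
lemma le_of_riccati {f : ℝ → ℝ} (hf : Differentiable ℝ f) {C x : ℝ} (hC : 1 ≤ C)
    (h : ∀ t ∈ Icc (x - 1) x, C < f t → deriv f t ≤ -(f t) ^ 2) : f x ≤ C := by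
  by_contra! hx
  have hd : ∀ s, HasDerivAt (fun s => f (x - s)) (-deriv f (x - s)) s := fun s => by
    have := (hf (x - s)).hasDerivAt.comp s ((hasDerivAt_id s).const_sub x)
    simpa [Function.comp_def] using this
  -- Going left, `f` cannot drop below `f x > C`: at contact the hypothesis forces strict growth.
  have h1 : ∀ s ∈ Icc (0 : ℝ) 1, f x ≤ f (x - s) := by
    intro s hs
    have := image_le_of_deriv_right_lt_deriv_boundary (f := fun s => -f (x - s))
      (f' := fun s => deriv f (x - s)) (a := 0) (b := 1) (B := fun _ => -f x) (B' := fun _ => 0)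
      (by
        have : Continuous f := hf.continuous
        fun_prop)
      (fun s _ => by simpa using! (hd s).neg.hasDerivWithinAt) (by simp)
      (fun s => hasDerivAt_const _ _)
      (fun s hs he => by
        have he' : f (x - s) = f x := by linarith
        have := h (x - s) ⟨by linarith [hs.2], by linarith [hs.1]⟩ (by rw [he']; exact hx)
        have h2 : 0 < (f (x - s)) ^ 2 := by exact pow_pos (by rw [he']; linarith) 2
        linarith) hs
    linarith
  have hpos : ∀ s ∈ Icc (0 : ℝ) 1, 0 < f (x - s) := fun s hs => by linarith [h1 s hs]
  -- The Riccati inequality makes `1 / f (x - s) + s` nonincreasing; as it starts below `1`, `1 / f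
  -- (x - 1)` would be negative.
  have hd2 : ∀ s ∈ Icc (0 : ℝ) 1, HasDerivAt (fun s => (f (x - s))⁻¹ + s)
      (-(-deriv f (x - s)) / (f (x - s)) ^ 2 + 1) s := fun s hs =>
    ((hd s).inv (hpos s hs).ne').add (hasDerivAt_id s)
  have hanti : AntitoneOn (fun s => (f (x - s))⁻¹ + s) (Icc (0 : ℝ) 1) := by
    refine antitoneOn_of_deriv_nonpos (convex_Icc 0 1)
      (fun s hs => (hd2 s hs).continuousAt.continuousWithinAt)
      (fun s hs => (hd2 s (interior_subset hs)).differentiableAt.differentiableWithinAt)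
      (fun s hs => ?_)
    have hs := interior_subset hs
    rw [(hd2 s hs).deriv]
    have h3 := h (x - s) ⟨by linarith [hs.2], by linarith [hs.1]⟩ (by linarith [h1 s hs])
    have h4 := pow_pos (hpos s hs) 2
    have : -(-deriv f (x - s)) / (f (x - s)) ^ 2 ≤ -1 := by
      rw [div_le_iff₀ h4]; linarith
    linarith
  have h5 := hanti (left_mem_Icc.2 zero_le_one) (right_mem_Icc.2 zero_le_one) zero_le_one
  simp only [sub_zero, add_zero] at h5
  have h6 : 0 < (f (x - 1))⁻¹ := inv_pos.2 (hpos 1 (right_mem_Icc.2 zero_le_one))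
  have h7 : (f x)⁻¹ < 1 := inv_lt_one_of_one_lt₀ (by linarith)
  linarith

/-- The reflection `s ↦ -f (-s)` preserves `f' ≤ -f ^ 2`; here the blow-up is to the right. -/
lemma ge_of_riccati {f : ℝ → ℝ} (hf : Differentiable ℝ f) {C x : ℝ} (hC : 1 ≤ C)
    (h : ∀ t ∈ Icc x (x + 1), f t < -C → deriv f t ≤ -(f t) ^ 2) : -C ≤ f x := by
  have hd : ∀ s, HasDerivAt (fun s => -f (-s)) (deriv f (-s)) s := fun s => by
    have := ((hf (-s)).hasDerivAt.comp s (hasDerivAt_neg s)).neg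
    simpa [Function.comp_def] using! this
  have := le_of_riccati (f := fun s => -f (-s)) (fun s => (hd s).differentiableAt) (x := -x) hC
    (fun t ht hlt => by
      rw [(hd t).deriv]
      have := h (-t) ⟨by linarith [ht.2], by linarith [ht.1]⟩ (by linarith)
      simpa using this)
  simp only [neg_neg] at this
  linarith

/-! ### A priori bounds and non-crossing for the deterministic equation -/

/-- Assumptions on the coefficients of the deterministic equation `a(x) f' + H(x, f) = lam`. -/
structure IsCoercivePair (α₀ α₁ γ : ℝ) (a : ℝ → ℝ) (H : ℝ → ℝ → ℝ) : Prop where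
  α₀_pos : 0 < α₀
  α₁_pos : 0 < α₁
  two_lt : 2 < γ
  continuous_a : Continuous a
  nonneg : ∀ x, 0 ≤ a x
  le_one : ∀ x, a x ≤ 1
  continuous_H : Continuous fun q : ℝ × ℝ => H q.1 q.2
  lower : ∀ x p, α₀ * |p| ^ γ - 1 / α₀ ≤ H x p
  upper : ∀ x p, H x p ≤ α₁ * (|p| ^ γ + 1)
  lipschitz_p : ∀ x p q, |H x p - H x q| ≤ α₁ * (|p| + |q| + 1) ^ (γ - 1) * |p - q|

/-- Beyond `C` the coercivity of the Hamiltonian at levels at most `lam` beats a square. -/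
def IsCoercivityBound (α₀ γ lam C : ℝ) : Prop :=
  1 ≤ C ∧ ∀ p : ℝ, C ≤ |p| → lam + 1 / α₀ + p ^ 2 ≤ α₀ * |p| ^ γ

lemma IsCoercivityBound.anti {α₀ γ lam mu C : ℝ} (h : IsCoercivityBound α₀ γ lam C)
    (hmu : mu ≤ lam) : IsCoercivityBound α₀ γ mu C :=
  ⟨h.1, fun p hp => by linarith [h.2 p hp]⟩

/-- Write `|p| ^ γ = p ^ 2 * |p| ^ (γ - 2)`; the last factor tends to infinity because `γ > 2`. -/
lemma exists_isCoercivityBound {α₀ γ : ℝ} (hα₀ : 0 < α₀) (hγ : 2 < γ) (lam : ℝ) :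
    ∃ C, IsCoercivityBound α₀ γ lam C := by
  have h1 : ∀ᶠ r : ℝ in atTop, (1 + |lam| + 1 / α₀) / α₀ ≤ r ^ (γ - 2) :=
    (tendsto_rpow_atTop (by linarith : 0 < γ - 2)).eventually_ge_atTop _
  obtain ⟨C, hC⟩ := (h1.and (eventually_ge_atTop 1)).exists_forall_of_atTop
  refine ⟨max C 1, le_max_right _ _, fun p hp => ?_⟩
  obtain ⟨h2, h3⟩ := hC |p| ((le_max_left _ _).trans hp)
  have h4 : |p| ^ γ = p ^ 2 * |p| ^ (γ - 2) := by
    rw [← sq_abs, ← Real.rpow_natCast |p| 2, ← Real.rpow_add (by linarith)]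
    norm_num
  rw [div_le_iff₀ hα₀] at h2
  have h5 : 1 ≤ p ^ 2 := by rw [← sq_abs]; nlinarith
  have h6 : 0 < 1 / α₀ := by positivity
  calc lam + 1 / α₀ + p ^ 2 ≤ p ^ 2 * (1 + |lam| + 1 / α₀) := by
        nlinarith [le_abs_self lam, abs_nonneg lam]
    _ ≤ p ^ 2 * (|p| ^ (γ - 2) * α₀) := by gcongr
    _ = _ := by rw [h4]; ring

namespace IsCoercivePair

variable {α₀ α₁ γ : ℝ} {a : ℝ → ℝ} {H : ℝ → ℝ → ℝ}

/-- Coercivity gives `a x * d ≤ -p ^ 2`. Hence `d < 0`, and then `a x ≤ 1` gives `d ≤ a x * d`. -/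
lemma deriv_le_neg_sq (hp : IsCoercivePair α₀ α₁ γ a H) {lam C x d p : ℝ}
    (hC : IsCoercivityBound α₀ γ lam C) (heq : a x * d + H x p = lam) (hlt : C < |p|) :
    d ≤ -p ^ 2 := by
  have h1 := hC.2 p hlt.le
  have h2 := hp.lower x p
  have h3 : a x * d ≤ -p ^ 2 := by linarith
  have h5 : 0 < p ^ 2 := by
    rw [← sq_abs]; have := hC.1; exact pow_pos (by linarith) 2
  have h6 : d < 0 := by
    by_contra! h
    have := mul_nonneg (hp.nonneg x) h
    linarith
  nlinarith [hp.le_one x]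

/-- An interior estimate: the unit to the left serves the upper bound, the unit to the right the
lower one. The bound does not depend on how small `a` is. -/
lemma abs_le_of_eq (hp : IsCoercivePair α₀ α₁ γ a H) {lam C x : ℝ} {f : ℝ → ℝ}
    (hC : IsCoercivityBound α₀ γ lam C) (hf : Differentiable ℝ f)
    (heq : ∀ t ∈ Icc (x - 1) (x + 1), a t * deriv f t + H t (f t) = lam) : |f x| ≤ C := by
  have hC1 := hC.1
  refine abs_le.2 ⟨ge_of_riccati hf hC.1 fun t ht hlt => ?_,
    le_of_riccati hf hC.1 fun t ht hlt => ?_⟩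
  · refine hp.deriv_le_neg_sq hC (heq t ⟨by linarith [ht.1], ht.2⟩) ?_
    rw [abs_of_neg (by linarith)]; linarith
  · exact hp.deriv_le_neg_sq hC (heq t ⟨ht.1, by linarith [ht.2]⟩) (hlt.trans_le (le_abs_self _))

lemma abs_le_of_mem (hp : IsCoercivePair α₀ α₁ γ a H) {lam C : ℝ} {f : ℝ → ℝ}
    (hC : IsCoercivityBound α₀ γ lam C) (hf : f ∈ odeSolutions a H lam) (x : ℝ) : |f x| ≤ C :=
  hp.abs_le_of_eq hC (hf.1.differentiable one_ne_zero) fun t _ => hf.2 t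

lemma lipschitzOnWith (hp : IsCoercivePair α₀ α₁ γ a H) {M x p q : ℝ} (h1 : |p| ≤ M)
    (h2 : |q| ≤ M) : |H x p - H x q| ≤ α₁ * (2 * M + 1) ^ (γ - 1) * |p - q| := by
  refine (hp.lipschitz_p x p q).trans ?_
  have := hp.α₁_pos
  have := hp.two_lt
  have := abs_nonneg p
  have := abs_nonneg q
  gcongr ?_ * ?_ ^ _ * _
  · linarith
  · linarith

lemma exists_pos_le (hp : IsCoercivePair α₀ α₁ γ a H) (hpos : ∀ x, 0 < a x) (b c : ℝ) :
    ∃ m, 0 < m ∧ ∀ x ∈ Icc b c, m ≤ a x := by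
  rcases (Icc b c).eq_empty_or_nonempty with h | h
  · exact ⟨1, one_pos, by simp [h]⟩
  · obtain ⟨y, -, hy⟩ := isCompact_Icc.exists_isMinOn h hp.continuous_a.continuousOn
    exact ⟨a y, hpos y, fun x hx => hy hx⟩

lemma continuous_field (hp : IsCoercivePair α₀ α₁ γ a H) (hpos : ∀ x, 0 < a x) (lam : ℝ) :
    Continuous fun q : ℝ × ℝ => (lam - H q.1 q.2) / a q.1 :=
  (continuous_const.sub hp.continuous_H).div (hp.continuous_a.comp continuous_fst)
    fun q => (hpos q.1).ne'

lemma hasDerivAt_of_mem (hpos : ∀ x, 0 < a x) {lam : ℝ}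
    {f : ℝ → ℝ} (hf : f ∈ odeSolutions a H lam) (x : ℝ) :
    HasDerivAt f ((lam - H x (f x)) / a x) x := by
  have h := (hf.1.differentiable one_ne_zero x).hasDerivAt
  rwa [show deriv f x = (lam - H x (f x)) / a x from by
    rw [eq_div_iff (hpos x).ne']; linarith [hf.2 x]] at h

/-- Both solutions stay in `|p| ≤ C`, where the field `(lam - H) / a` is Lipschitz in `p`, uniformly
on bounded intervals. -/
lemma eq_of_mem (hp : IsCoercivePair α₀ α₁ γ a H) (hpos : ∀ x, 0 < a x) {lam : ℝ} {f g : ℝ → ℝ}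
    (hf : f ∈ odeSolutions a H lam) (hg : g ∈ odeSolutions a H lam) {x₀ : ℝ} (h0 : f x₀ = g x₀) :
    f = g := by
  obtain ⟨C, hC⟩ := exists_isCoercivityBound hp.α₀_pos hp.two_lt lam
  funext y
  set R := |x₀| + |y| + 1 with hR
  obtain ⟨m, hm, hma⟩ := hp.exists_pos_le hpos (-R) R
  have hC0 : 0 ≤ C := by linarith [hC.1]
  have hK : 0 ≤ α₁ * (2 * C + 1) ^ (γ - 1) / m := by have := hp.α₁_pos; positivity
  refine ODE_solution_unique_of_mem_Ioo (v := fun t p => (lam - H t p) / a t)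
    (K := Real.toNNReal (α₁ * (2 * C + 1) ^ (γ - 1) / m)) (s := fun _ => {p | |p| ≤ C}) (a := -R) (b := R)
    (t₀ := x₀) (fun t ht => ?_) ?_
    (fun t _ => ⟨hasDerivAt_of_mem hpos hf t, hp.abs_le_of_mem hC hf t⟩)
    (fun t _ => ⟨hasDerivAt_of_mem hpos hg t, hp.abs_le_of_mem hC hg t⟩) h0 ?_
  · refine LipschitzOnWith.of_dist_le_mul fun p hp1 q hq1 => ?_
    have h1 := hp.lipschitzOnWith (x := t) hp1 hq1
    have h2 := hma t (Ioo_subset_Icc_self ht)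
    rw [Real.dist_eq, Real.dist_eq, div_sub_div_same, abs_div, abs_of_pos (hpos t)]
    have h3 : |lam - H t p - (lam - H t q)| = |H t p - H t q| := by
      rw [← abs_neg]; congr 1; ring
    rw [h3]
    calc |H t p - H t q| / a t ≤ (α₁ * (2 * C + 1) ^ (γ - 1) * |p - q|) / m :=
          div_le_div₀ ((abs_nonneg _).trans h1) h1 hm h2
      _ = _ := by rw [Real.coe_toNNReal _ hK]; ring
  · constructor <;> cases abs_cases x₀ <;> linarith [abs_nonneg y]
  · constructor <;> cases abs_cases y <;> linarith [abs_nonneg x₀]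

/-- Solutions of the scalar equation do not cross. -/
lemma le_of_le (hp : IsCoercivePair α₀ α₁ γ a H) (hpos : ∀ x, 0 < a x) {lam : ℝ} {f g : ℝ → ℝ}
    (hf : f ∈ odeSolutions a H lam) (hg : g ∈ odeSolutions a H lam) {x₀ : ℝ} (h0 : f x₀ ≤ g x₀) :
    f ≤ g := by
  intro y
  by_contra! hy
  have hc : Continuous fun t => f t - g t := hf.1.continuous.sub hg.1.continuous
  obtain ⟨z, -, hz⟩ := (isPreconnected_univ (α := ℝ)).intermediate_value (mem_univ x₀)
    (mem_univ y) hc.continuousOn (show (0 : ℝ) ∈ Icc (f x₀ - g x₀) (f y - g y) from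
      ⟨by linarith, by linarith⟩)
  have := hp.eq_of_mem hpos hf hg (x₀ := z) (by linarith [show f z - g z = 0 from hz])
  rw [this] at hy
  exact lt_irrefl _ hy

/-! ### Compactness of approximate solutions -/

/-- Pointwise limits of bounded approximate solutions along an ultrafilter are solutions. -/
lemma exists_mem_of_approx (hp : IsCoercivePair α₀ α₁ γ a H) (hpos : ∀ x, 0 < a x) {lam M : ℝ}
    {x₀ σ c : ℝ}
    (h : ∀ n : ℕ, ∃ g : ℝ → ℝ, Differentiable ℝ g ∧ (∀ x ∈ Icc (-(n : ℝ)) n, |g x| ≤ M ∧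
      |a x * deriv g x + H x (g x) - lam| ≤ 1 / ((n : ℝ) + 1)) ∧
      c - 1 / ((n : ℝ) + 1) ≤ σ * g x₀) :
    ∃ f ∈ odeSolutions a H lam, c ≤ σ * f x₀ := by
  choose g hg hgn hgc using h
  -- Along an ultrafilter all pointwise limits exist at once by compactness of `[-M, M]`, without
  -- extracting subsequences.
  set U : Ultrafilter ℕ := hyperfilter ℕ
  have hU : (U : Filter ℕ) ≤ atTop := by
    rw [← Nat.cofinite_eq_atTop]; exact hyperfilter_le_cofinite
  have hev : ∀ R : ℝ, ∀ᶠ n : ℕ in U, R ≤ n := fun R =>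
    hU (tendsto_natCast_atTop_atTop.eventually_ge_atTop R)
  have hzero : Tendsto (fun n : ℕ => 1 / ((n : ℝ) + 1)) U (𝓝 0) :=
    tendsto_one_div_add_atTop_nhds_zero_nat.mono_left hU
  have hlim : ∀ x, ∃ y, Tendsto (fun n => g n x) U (𝓝 y) := by
    intro x
    have hle : ((U.map fun n => g n x : Ultrafilter ℝ) : Filter ℝ) ≤ 𝓟 (Icc (-M) M) := by
      rw [le_principal_iff]
      show ∀ᶠ n in (U : Filter ℕ), g n x ∈ Icc (-M) M
      filter_upwards [hev |x|] with n hn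
      exact abs_le.1 (hgn n x (abs_le.1 hn)).1
    obtain ⟨y, -, hy⟩ := isCompact_Icc.ultrafilter_le_nhds _ hle
    exact ⟨y, hy⟩
  choose f hf using hlim
  set v : ℝ × ℝ → ℝ := fun q => (lam - H q.1 q.2) / a q.1 with hv
  have hvc : Continuous v := hp.continuous_field hpos lam
  have hderiv : ∀ x, HasDerivAt f (v (x, f x)) x := by
    intro x
    obtain ⟨m, hm, hma⟩ := hp.exists_pos_le hpos (x - 1) (x + 1)
    have hcomp : IsCompact (Icc (x - 1) (x + 1) ×ˢ Icc (-M) M) := isCompact_Icc.prod isCompact_Icc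
    obtain ⟨K₀, hK₀⟩ := hcomp.exists_bound_of_continuousOn hvc.continuousOn
    have hvu := hcomp.uniformContinuousOn_of_continuous hvc.continuousOn
    rw [Metric.uniformContinuousOn_iff] at hvu
    -- derivatives of the approximations
    have hsub : ∀ n : ℕ, |x| + 1 ≤ n → ∀ t ∈ Icc (x - 1) (x + 1), t ∈ Icc (-(n : ℝ)) n := by
      intro n hn t ht
      have h1 := neg_abs_le x
      have h2 := le_abs_self x
      exact ⟨by linarith [ht.1], by linarith [ht.2]⟩
    have hres : ∀ n : ℕ, |x| + 1 ≤ n → ∀ t ∈ Icc (x - 1) (x + 1),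
        |deriv (g n) t - v (t, g n t)| ≤ 1 / ((n : ℝ) + 1) / m := by
      intro n hn t ht
      have h1 := (hgn n t (hsub n hn t ht)).2
      have h2 : deriv (g n) t - v (t, g n t)
          = (a t * deriv (g n) t + H t (g n t) - lam) / a t := by
        simp only [hv]; field_simp [(hpos t).ne']; ring
      rw [h2, abs_div, abs_of_pos (hpos t)]
      exact div_le_div₀ (by positivity) h1 hm (hma t ht)
    set K := |K₀| + 1 / m with hK
    have hKpos : 0 < K := by positivity
    have hdb : ∀ n : ℕ, |x| + 1 ≤ n → ∀ t ∈ Icc (x - 1) (x + 1), |deriv (g n) t| ≤ K := by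
      intro n hn t ht
      have h1 := hres n hn t ht
      have h2 := hK₀ (t, g n t) ⟨ht, abs_le.1 (hgn n t (hsub n hn t ht)).1⟩
      rw [Real.norm_eq_abs] at h2
      have h3 : 1 / ((n : ℝ) + 1) / m ≤ 1 / m := by
        gcongr
        rw [div_le_one (by positivity)]
        linarith [n.cast_nonneg (α := ℝ)]
      have h4 := abs_sub_abs_le_abs_sub (deriv (g n) t) (v (t, g n t))
      linarith [le_abs_self K₀]
    rw [hasDerivAt_iff_isLittleO, Asymptotics.isLittleO_iff]
    intro ε hε
    obtain ⟨δ, hδ, hδv⟩ := hvu (ε / 2) (by positivity)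
    -- The approximations are `K`-Lipschitz near `x`, so for `|t - x| < r` the points of their
    -- graphs over `t` and `x` are `δ`-close.
    set r := min 1 (min (δ / 2) (δ / 2 / K)) with hr
    have hrpos : 0 < r := by positivity
    have hr1 : r ≤ 1 := min_le_left _ _
    have hr2 : r ≤ δ / 2 := (min_le_right _ _).trans (min_le_left _ _)
    have hr3 : r ≤ δ / 2 / K := (min_le_right _ _).trans (min_le_right _ _)
    filter_upwards [Metric.ball_mem_nhds x hrpos] with y hy
    have hsubr : ∀ t ∈ Metric.ball x r, t ∈ Icc (x - 1) (x + 1) := by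
      intro t ht
      rw [Metric.mem_ball, Real.dist_eq, abs_lt] at ht
      exact ⟨by linarith [ht.1], by linarith [ht.2]⟩
    have hxr : x ∈ Metric.ball x r := Metric.mem_ball_self hrpos
    -- The first-order expansion at `x` holds with an error uniform in `n`, so it passes to the
    -- limit.
    have key : ∀ᶠ n : ℕ in U,
        ‖g n y - g n x - (y - x) • v (x, g n x)‖ ≤ ε * ‖y - x‖ := by
      have h1 : ∀ᶠ n : ℕ in U, 1 / ((n : ℝ) + 1) < ε / 2 * m :=
        hzero.eventually_lt_const (by positivity)
      filter_upwards [h1, hev (|x| + 1)] with n hn1 hn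
      have hmv := (convex_ball x r).norm_image_sub_le_of_norm_hasDerivWithin_le
        (f := fun t => g n t - t * v (x, g n x))
        (f' := fun t => deriv (g n) t - v (x, g n x)) (C := ε)
        (fun t _ => by
          have h1 := ((hg n t).hasDerivAt.sub
            ((hasDerivAt_id t).mul_const (v (x, g n x)))).hasDerivWithinAt (s := Metric.ball x r)
          simpa using! h1)
        (fun t ht => by
          have ht1 := hsubr t ht
          have hlip : |g n t - g n x| ≤ K * |t - x| := by
            simpa using (convex_Icc (x - 1) (x + 1)).norm_image_sub_le_of_norm_hasDerivWithin_le
              (f := g n) (f' := deriv (g n)) (C := K)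
              (fun s _ => (hg n s).hasDerivAt.hasDerivWithinAt) (fun s hs => hdb n hn s hs)
              (hsubr x hxr) ht1
          have htx : |t - x| < r := by rwa [Metric.mem_ball, Real.dist_eq] at ht
          have hd : dist (t, g n t) (x, g n x) < δ := by
            rw [Prod.dist_eq, max_lt_iff, Real.dist_eq, Real.dist_eq]
            refine ⟨by linarith, ?_⟩
            have h3 : K * |t - x| ≤ K * (δ / 2 / K) := by gcongr; linarith
            rw [mul_div_cancel₀ _ hKpos.ne'] at h3
            linarith
          have h5 := hδv (t, g n t) ⟨ht1, abs_le.1 (hgn n t (hsub n hn t ht1)).1⟩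
            (x, g n x) ⟨hsubr x hxr, abs_le.1 (hgn n x (hsub n hn x (hsubr x hxr))).1⟩ hd
          rw [Real.dist_eq] at h5
          have h6 := hres n hn t ht1
          have h7 : 1 / ((n : ℝ) + 1) / m < ε / 2 := by rwa [div_lt_iff₀ hm]
          have h8 := abs_sub_le (deriv (g n) t) (v (t, g n t)) (v (x, g n x))
          rw [Real.norm_eq_abs]
          linarith) hxr hy
      refine le_trans (le_of_eq ?_) hmv
      congr 1
      simp only [smul_eq_mul]
      ring
    have hl : Tendsto (fun n : ℕ => ‖g n y - g n x - (y - x) • v (x, g n x)‖) U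
        (𝓝 ‖f y - f x - (y - x) • v (x, f x)‖) := by
      have hvx : Tendsto (fun n => v (x, g n x)) U (𝓝 (v (x, f x))) :=
        (hvc.tendsto (x, f x)).comp (tendsto_const_nhds.prodMk_nhds (hf x))
      exact (((hf y).sub (hf x)).sub (hvx.const_smul (y - x))).norm
    exact le_of_tendsto hl key
  refine ⟨f, ⟨?_, fun x => ?_⟩, ?_⟩
  · have hdiff : Differentiable ℝ f := fun x => (hderiv x).differentiableAt
    rw [contDiff_one_iff_deriv]
    refine ⟨hdiff, ?_⟩
    rw [show deriv f = fun x => v (x, f x) from funext fun x => (hderiv x).deriv]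
    exact hvc.comp (continuous_id.prodMk hdiff.continuous)
  · rw [(hderiv x).deriv]
    simp only [hv]
    field_simp [(hpos x).ne']
    ring
  · refine le_of_tendsto_of_tendsto' (b := (U : Filter ℕ)) (f := fun n : ℕ => c - 1 / ((n : ℝ) + 1))
      ?_ ((hf x₀).const_mul σ) hgc
    simpa using hzero.const_sub c

end IsCoercivePair

/-! ### Viscosity supersolutions -/

lemma exists_isLocalMin_Ioo {w : ℝ → ℝ} {x y z : ℝ} (hw : ContinuousOn w (Icc x z))
    (hy : y ∈ Icc x z) (hx : w y < w x) (hz : w y < w z) : ∃ m ∈ Ioo x z, IsLocalMin w m := by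
  refine isCompact_Icc.exists_isLocalMin_mem_open Ioo_subset_Icc_self hw hy (fun t ht => ?_)
    isOpen_Ioo
  have hxz : x ≤ z := hy.1.trans hy.2
  rw [Icc_sdiff_Ioo_same hxz] at ht
  rcases ht with rfl | rfl
  · exact hx
  · exact hz

/-- Were the second derivative negative, `x` would also be a local maximum, so `w` would be locally
constant. -/
lemma deriv_deriv_nonneg_of_isLocalMin {w : ℝ → ℝ} {x : ℝ} (hw : Continuous w)
    (h : IsLocalMin w x) : 0 ≤ deriv (deriv w) x := by
  by_contra! hlt
  have hmax := isLocalMax_of_deriv_deriv_neg hlt h.deriv_eq_zero hw.continuousAt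
  have heq : w =ᶠ[𝓝 x] fun _ => w x := by
    filter_upwards [h, hmax] with y h1 h2 using le_antisymm h2 h1
  have h3 : deriv (deriv w) x = 0 := by
    rw [heq.deriv.deriv_eq]; simp
  linarith

/-- Classical supersolutions are viscosity supersolutions. -/
lemma isViscositySupersolution_of_contDiff {a : ℝ → ℝ} {H : ℝ → ℝ → ℝ} {lam : ℝ} {u : ℝ → ℝ}
    (ha : ∀ x, 0 ≤ a x) (hu : ContDiff ℝ 2 u)
    (h : ∀ x, a x * deriv (deriv u) x + H x (deriv u x) ≤ lam) :
    IsViscositySupersolution a H lam u := by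
  refine ⟨hu.continuous, fun φ x₀ hφ hmin => ?_⟩
  have hd : ∀ {f : ℝ → ℝ}, ContDiff ℝ 2 f → Differentiable ℝ f ∧ Differentiable ℝ (deriv f) := by
    intro f hf
    refine ⟨hf.differentiable two_ne_zero, ?_⟩
    rw [show (2 : WithTop ℕ∞) = 1 + 1 from (one_add_one_eq_two).symm,
      contDiff_succ_iff_deriv] at hf
    exact hf.2.2.differentiable one_ne_zero
  have h1 : deriv (fun x => u x - φ x) = fun x => deriv u x - deriv φ x :=
    funext fun x => deriv_fun_sub ((hd hu).1 x) ((hd hφ).1 x)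
  have h2 := deriv_deriv_nonneg_of_isLocalMin (w := fun x => u x - φ x) (hu.continuous.sub hφ.continuous) hmin
  have h3 := hmin.deriv_eq_zero
  rw [h1] at h2 h3
  rw [deriv_fun_sub ((hd hu).2 x₀) ((hd hφ).2 x₀)] at h2
  have h4 : deriv φ x₀ = deriv u x₀ := by linarith
  rw [h4]
  have := mul_le_mul_of_nonneg_left (sub_nonneg.1 h2) (ha x₀)
  linarith [h x₀]

namespace IsCoercivePair

variable {α₀ α₁ γ : ℝ} {a : ℝ → ℝ} {H : ℝ → ℝ → ℝ}

lemma neg_one_div_le (hp : IsCoercivePair α₀ α₁ γ a H) (x p : ℝ) : -(1 / α₀) ≤ H x p := by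
  have h1 := hp.lower x p
  have h2 : 0 ≤ α₀ * |p| ^ γ := by have := hp.α₀_pos; positivity
  linarith

/-- Viscosity supersolutions are semiconcave, hence Lipschitz, on bounded intervals. -/
lemma exists_lipschitz_of_supersolution (hp : IsCoercivePair α₀ α₁ γ a H) (hpos : ∀ x, 0 < a x)
    {mu : ℝ} {u : ℝ → ℝ} (hu : IsViscositySupersolution a H mu u) (R : ℝ) :
    ∃ L, 0 ≤ L ∧ ∀ x ∈ Metric.ball (0 : ℝ) R, ∀ y ∈ Metric.ball (0 : ℝ) R,
      |u x - u y| ≤ L * |x - y| := by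
  obtain ⟨m, hm, hma⟩ := hp.exists_pos_le hpos (-(R + 1)) (R + 1)
  -- With this `K`, a test parabola `K * t ^ 2 + s * t` has `a * 2K + H > mu` and can never touch
  -- `u` from below.
  set K := (|mu| + 1 / α₀ + 1) / m with hK
  have hα := hp.α₀_pos
  have hKpos : 0 < K := by positivity
  have hsub : Metric.ball (0 : ℝ) (R + 1) ⊆ Icc (-(R + 1)) (R + 1) := by
    rw [Real.ball_eq_Ioo]; simpa using Ioo_subset_Icc_self
  have hvc : Continuous fun x => u x - K * x ^ 2 := by have := hu.1; fun_prop
  have hconc : ConcaveOn ℝ (Metric.ball (0 : ℝ) (R + 1)) fun x => u x - K * x ^ 2 := by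
    refine concaveOn_of_slope_anti_adjacent (convex_ball _ _) fun {x y z} hx hz hxy hyz => ?_
    -- If slopes increased, subtracting a line of intermediate slope `s` would produce an interior
    -- minimum, that is, a touching parabola.
    by_contra! hlt
    obtain ⟨s, hs1, hs2⟩ := exists_between hlt
    rw [div_lt_iff₀ (sub_pos.2 hxy)] at hs1
    rw [lt_div_iff₀ (sub_pos.2 hyz)] at hs2
    obtain ⟨t, ht, hmin⟩ := exists_isLocalMin_Ioo (w := fun t => u t - (K * t ^ 2 + s * t))
      (x := x) (y := y) (z := z) (by have := hu.1; fun_prop) ⟨hxy.le, hyz.le⟩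
      (by linarith) (by linarith)
    have hd1 : deriv (fun t : ℝ => K * t ^ 2 + s * t) = fun t => K * (2 * t) + s := by
      funext t
      have := (((hasDerivAt_pow 2 t).const_mul K).add ((hasDerivAt_id t).const_mul s)).deriv
      simpa using! this
    have hd2 : deriv (fun t : ℝ => K * (2 * t) + s) t = 2 * K := by
      have := ((((hasDerivAt_id t).const_mul 2).const_mul K).add_const s).deriv
      rw [show (fun t : ℝ => K * (2 * t) + s) = fun t => K * (2 * id t) + s from rfl, this]
      ring
    have h1 := hu.2 (fun t => K * t ^ 2 + s * t) t (by fun_prop) hmin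
    rw [hd1, hd2] at h1
    have h2 := hp.neg_one_div_le t (K * (2 * t) + s)
    have h3 := hma t (hsub ((convex_ball (0 : ℝ) (R + 1)).ordConnected.out hx hz
      (Ioo_subset_Icc_self ht)))
    have h4 : m * K = |mu| + 1 / α₀ + 1 := by rw [hK]; field_simp
    have h5 : m * K ≤ a t * K := by gcongr
    have h6 : 0 < m * K := by positivity
    linarith [le_abs_self mu]
  obtain ⟨L, hL⟩ := hconc.exists_lipschitzOnWith_of_isBounded (r' := R) (by linarith)
    ((isCompact_Icc.image hvc).isBounded.subset (image_mono hsub))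
  have hR : ∀ {x : ℝ}, x ∈ Metric.ball (0 : ℝ) R → |x| ≤ |R| := fun {x} hx => by
    rw [mem_ball_zero_iff, Real.norm_eq_abs] at hx
    exact hx.le.trans (le_abs_self R)
  refine ⟨L + K * (2 * |R|), by positivity, fun x hx y hy => ?_⟩
  have h1 := hL.dist_le_mul x hx y hy
  rw [Real.dist_eq, Real.dist_eq] at h1
  have h2 : |K * x ^ 2 - K * y ^ 2| ≤ K * (2 * |R|) * |x - y| := by
    rw [show K * x ^ 2 - K * y ^ 2 = K * (x + y) * (x - y) by ring, abs_mul, abs_mul,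
      abs_of_pos hKpos]
    gcongr
    linarith [abs_add_le x y, hR hx, hR hy]
  have h3 := abs_add_le (u x - K * x ^ 2 - (u y - K * y ^ 2)) (K * x ^ 2 - K * y ^ 2)
  rw [show u x - K * x ^ 2 - (u y - K * y ^ 2) + (K * x ^ 2 - K * y ^ 2) = u x - u y by ring] at h3
  linarith

/-- Global solvability of the initial value problem with the Hamiltonian truncated in `p`. -/
lemma exists_truncated_solution (hp : IsCoercivePair α₀ α₁ γ a H) (hpos : ∀ x, 0 < a x)
    (lam y₀ : ℝ) {R M : ℝ} (hR : 0 ≤ R) (hM : -M ≤ M) :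
    ∃ g : ℝ → ℝ, ContDiff ℝ 1 g ∧ g (-R) = y₀ ∧ ∀ x ∈ Icc (-R) R,
      a x * deriv g x + H x (projIcc (-M) M hM (g x)) = lam := by
  obtain ⟨m, hm, hma⟩ := hp.exists_pos_le hpos (-R) R
  have hRR : -R ≤ R := by linarith
  have hvc := hp.continuous_field hpos lam
  obtain ⟨L, hL⟩ := ((isCompact_Icc (a := -R) (b := R)).prod
    (isCompact_Icc (a := -M) (b := M))).exists_bound_of_continuousOn hvc.continuousOn
  have hcl : ∀ p : ℝ, (projIcc (-M) M hM p : ℝ) ∈ Icc (-M) M := fun p => Subtype.coe_prop _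
  have hM0 : 0 ≤ M := by linarith
  have hK : 0 ≤ α₁ * (2 * M + 1) ^ (γ - 1) / m := by have := hp.α₁_pos; positivity
  set v : ℝ → ℝ → ℝ := fun t p => (lam - H t (projIcc (-M) M hM p)) / a t with hv
  have hvcont : Continuous (Function.uncurry v) := by
    have : Continuous fun q : ℝ × ℝ => (q.1, (projIcc (-M) M hM q.2 : ℝ)) :=
      continuous_fst.prodMk (continuous_subtype_val.comp (continuous_projIcc.comp continuous_snd))
    exact hvc.comp this
  -- The truncated field is bounded by `|L|`, so a ball of radius `|L| * (2 * R)` leaves room for a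
  -- solution on the whole interval.
  have hPL : IsPicardLindelof v (⟨-R, left_mem_Icc.2 hRR⟩ : Icc (-R) R) y₀
      (Real.toNNReal (|L| * (2 * R))) 0 (Real.toNNReal |L|)
      (Real.toNNReal (α₁ * (2 * M + 1) ^ (γ - 1) / m)) := by
    refine ⟨fun t ht => LipschitzOnWith.of_dist_le_mul fun p _ q _ => ?_, fun x _ => ?_,
      fun t ht x _ => ?_, ?_⟩
    · have h1 := hp.lipschitzOnWith (x := t) (abs_le.2 (hcl p)) (abs_le.2 (hcl q))
      have h2 : |(projIcc (-M) M hM p : ℝ) - projIcc (-M) M hM q| ≤ |p - q| := by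
        have := (LipschitzWith.projIcc hM).dist_le_mul p q
        rwa [NNReal.coe_one, one_mul] at this
      rw [Real.dist_eq, Real.dist_eq, hv, div_sub_div_same, abs_div, abs_of_pos (hpos t),
        Real.coe_toNNReal _ hK, sub_sub_sub_cancel_left, abs_sub_comm]
      have h3 : 0 ≤ α₁ * (2 * M + 1) ^ (γ - 1) := by have := hp.α₁_pos; positivity
      calc _ ≤ (α₁ * (2 * M + 1) ^ (γ - 1) * |p - q|) / m :=
            div_le_div₀ (by positivity) (h1.trans (by gcongr)) hm (hma t ht)
        _ = _ := by ring
    · exact (hvcont.comp (continuous_id.prodMk continuous_const)).continuousOn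
    · rw [Real.coe_toNNReal _ (abs_nonneg L)]
      exact (hL (t, _) ⟨ht, hcl x⟩).trans (le_abs_self L)
    · rw [Real.coe_toNNReal _ (abs_nonneg L), Real.coe_toNNReal _ (by positivity)]
      simp only [sub_self, NNReal.coe_zero, sub_zero]
      rw [max_eq_left (by linarith)]
      exact le_of_eq (by ring)
  obtain ⟨α, hα0, hα⟩ := hPL.exists_eq_forall_mem_Icc_hasDerivWithinAt₀
  have hαc : ContinuousOn α (Icc (-R) R) := fun t ht => (hα t ht).continuousWithinAt
  -- Extending the derivative continuously by constants makes the solution the restriction of a `C¹`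
  -- function on `ℝ`.
  set w : ℝ → ℝ := IccExtend hRR fun t => v t (α t) with hw
  have hwc : Continuous w := by
    refine Continuous.Icc_extend' ?_
    exact hvcont.comp (continuous_subtype_val.prodMk hαc.domRestrict)
  have hwx : ∀ x ∈ Icc (-R) R, w x = v x (α x) := fun x hx => IccExtend_of_mem _ _ hx
  have heq : EqOn (primitive (-R) w y₀) α (Icc (-R) R) := by
    refine eq_of_derivWithin_eq
      (fun t _ => (differentiable_primitive hwc _ _ t).differentiableWithinAt)
      (fun t ht => (hα t ht).differentiableWithinAt) (fun t ht => ?_) ?_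
    · have ht' := Ico_subset_Icc_self ht
      have hun := (uniqueDiffOn_Icc (ht.1.trans_lt ht.2)) t ht'
      rw [(hasDerivAt_primitive hwc _ _ t).hasDerivWithinAt.derivWithin hun,
        (hα t ht').derivWithin hun, hwx t ht']
    · rw [primitive_self]; exact hα0.symm
  refine ⟨primitive (-R) w y₀, contDiff_one_primitive hwc _ _, primitive_self _ _ _,
    fun x hx => ?_⟩
  rw [deriv_primitive hwc, heq hx, hwx x hx, hv]
  field_simp [(hpos x).ne']
  ring

/-- The bound `C` depends on neither `R` nor `u`, which is what allows `R → ∞`. -/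
lemma exists_bounded_solution_on (hp : IsCoercivePair α₀ α₁ γ a H) (hpos : ∀ x, 0 < a x)
    {lam mu C : ℝ} {u : ℝ → ℝ} (hu : IsViscositySupersolution a H mu u) (hlt : mu < lam)
    (hC : IsCoercivityBound α₀ γ lam C) {R : ℝ} (hR : 0 ≤ R) :
    ∃ g : ℝ → ℝ, Differentiable ℝ g ∧ ∀ x ∈ Icc (-R) R,
      |g x| ≤ C ∧ a x * deriv g x + H x (g x) = lam := by
  obtain ⟨L, hL0, hL⟩ := hp.exists_lipschitz_of_supersolution hpos hu (R + 2)
  -- The extra unit on each side is consumed by the interior estimate `abs_le_of_eq`.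
  set S := R + 1 with hS
  -- `M > C` makes `M` an upper barrier; starting at `M > L` makes `u - G` decrease initially.
  set M := max L C + 1 with hM
  have hLM : L < M := (le_max_left L C).trans_lt (lt_add_one _)
  have hCM : C < M := (le_max_right L C).trans_lt (lt_add_one _)
  have hMM : -M ≤ M := by linarith
  obtain ⟨g, hg, hg0, hgeq⟩ := hp.exists_truncated_solution hpos lam M
    (show 0 ≤ S by positivity) hMM
  have hgd : Differentiable ℝ g := hg.differentiable one_ne_zero
  have hball : ∀ x ∈ Icc (-S) S, x ∈ Metric.ball (0 : ℝ) (R + 2) := fun x hx => by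
    rw [mem_ball_zero_iff, Real.norm_eq_abs]
    have := abs_le.2 hx
    linarith
  have hupper : ∀ x ∈ Icc (-S) S, g x ≤ M := by
    intro x hx
    refine image_le_of_deriv_right_lt_deriv_boundary (f' := deriv g) (B := fun _ => M)
      (B' := fun _ => 0) hg.continuous.continuousOn
      (fun t _ => (hgd t).hasDerivAt.hasDerivWithinAt) hg0.le (fun t => hasDerivAt_const _ _)
      (fun t ht he => ?_) hx
    have h1 := hgeq t (Ico_subset_Icc_self ht)
    rw [he, projIcc_right] at h1
    have h2 := hp.deriv_le_neg_sq hC h1 (hCM.trans_le (le_abs_self M))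
    have : 0 < M ^ 2 := pow_pos (by linarith) 2
    linarith
  -- the antiderivative of `g` touches `u` from below only with a slope in `[-L, L]`
  set G := primitive 0 g 0 with hG
  have hGd : deriv G = g := deriv_primitive hg.continuous 0 0
  have hGc : Continuous fun x => u x - G x :=
    hu.1.sub (differentiable_primitive hg.continuous 0 0).continuous
  -- At a touching point the slope is within `[-L, L]`, where the truncation is inactive; there `G`
  -- solves the equation at level `lam > mu`, which the supersolution property forbids.
  have hno : ∀ x ∈ Ioo (-S) S, ¬ IsLocalMin (fun x => u x - G x) x := by
    intro x hx hmin
    have hslope : |g x| ≤ L := by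
      have hder := hasDerivAt_primitive hg.continuous 0 0 x
      have hev : ∀ᶠ y in 𝓝 x, G y - G x ≤ L * |y - x| := by
        filter_upwards [hmin, Ioo_mem_nhds hx.1 hx.2] with y hy1 hy2
        have h1 := hL y (hball y (Ioo_subset_Icc_self hy2)) x (hball x (Ioo_subset_Icc_self hx))
        have h2 := le_abs_self (u y - u x)
        linarith
      have ht := hasDerivAt_iff_tendsto_slope.1 hder
      refine abs_le.2 ⟨?_, ?_⟩
      · refine ge_of_tendsto (ht.mono_left (nhdsLT_le_nhdsNE x)) ?_
        filter_upwards [hev.filter_mono nhdsWithin_le_nhds, self_mem_nhdsWithin] with y hy1 hy2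
        have hy2 : y < x := hy2
        rw [slope_def_field, le_div_iff_of_neg (by linarith)]
        rw [abs_of_neg (by linarith)] at hy1
        linarith
      · refine le_of_tendsto (ht.mono_left (nhdsGT_le_nhdsNE x)) ?_
        filter_upwards [hev.filter_mono nhdsWithin_le_nhds, self_mem_nhdsWithin] with y hy1 hy2
        have hy2 : x < y := hy2
        rw [slope_def_field, div_le_iff₀ (by linarith)]
        rw [abs_of_pos (by linarith)] at hy1
        linarith
    have h1 := hu.2 G x (contDiff_two_primitive hg 0 0) hmin
    have h2 := hgeq x (Ioo_subset_Icc_self hx)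
    rw [projIcc_of_mem hMM (abs_le.1 (hslope.trans hLM.le))] at h2
    rw [hGd] at h1
    linarith
  -- If `g b < -L`, then `u - G` increases on reaching `b` and decreases on leaving `-S`, hence has
  -- an interior minimum.
  have hlower : ∀ x ∈ Icc (-S) S, -L ≤ g x := by
    intro b hb
    by_contra! hgb
    have hSb : -S < b := by
      refine lt_of_le_of_ne hb.1 fun h => ?_
      rw [← h, hg0] at hgb
      linarith
    obtain ⟨c, ⟨hc1, hc2⟩, hcw⟩ : ∃ c ∈ Ioo (-S) b, u c - G c < u (-S) - G (-S) := by
      have hder := hasDerivAt_iff_tendsto_slope.1 (hasDerivAt_primitive hg.continuous 0 0 (-S))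
      rw [hg0] at hder
      have := (hder.mono_left (nhdsGT_le_nhdsNE (-S))).eventually_const_lt hLM
      obtain ⟨c, h1, h2⟩ := (this.and (Ioo_mem_nhdsGT hSb)).exists
      refine ⟨c, h2, ?_⟩
      rw [slope_def_field, lt_div_iff₀ (by linarith [h2.1])] at h1
      have h3 := hL c (hball c ⟨h2.1.le, h2.2.le.trans hb.2⟩) (-S)
        (hball (-S) ⟨le_rfl, hb.1.trans hb.2⟩)
      rw [abs_of_pos (by linarith [h2.1] : 0 < c - -S)] at h3
      linarith [le_abs_self (u c - u (-S))]
    obtain ⟨d, ⟨hd1, hd2⟩, hdw⟩ : ∃ d ∈ Ioo (-S) b, u d - G d < u b - G b := by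
      have hder := hasDerivAt_iff_tendsto_slope.1 (hasDerivAt_primitive hg.continuous 0 0 b)
      have := (hder.mono_left (nhdsLT_le_nhdsNE b)).eventually_lt_const hgb
      obtain ⟨d, h1, h2⟩ := (this.and (Ioo_mem_nhdsLT hSb)).exists
      refine ⟨d, h2, ?_⟩
      rw [slope_def_field, div_lt_iff_of_neg (by linarith [h2.2])] at h1
      have h3 := hL d (hball d ⟨h2.1.le, h2.2.le.trans hb.2⟩) b (hball b hb)
      rw [abs_of_neg (by linarith [h2.2] : d - b < 0)] at h3
      linarith [le_abs_self (u d - u b)]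
    obtain ⟨e, he, he1, he2⟩ : ∃ e ∈ Icc (-S) b, u e - G e < u (-S) - G (-S) ∧
        u e - G e < u b - G b := by
      rcases le_total (u c - G c) (u d - G d) with h | h
      · exact ⟨c, ⟨hc1.le, hc2.le⟩, hcw, h.trans_lt hdw⟩
      · exact ⟨d, ⟨hd1.le, hd2.le⟩, h.trans_lt hcw, hdw⟩
    obtain ⟨x, hx, hmin⟩ := exists_isLocalMin_Ioo hGc.continuousOn he he1 he2
    exact hno x ⟨hx.1, hx.2.trans_le hb.2⟩ hmin
  have heq : ∀ x ∈ Icc (-S) S, a x * deriv g x + H x (g x) = lam := by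
    intro x hx
    have := hgeq x hx
    rwa [projIcc_of_mem hMM ⟨by linarith [hlower x hx], hupper x hx⟩] at this
  refine ⟨g, hgd, fun x hx => ⟨hp.abs_le_of_eq hC hgd fun t ht => heq t ?_, heq x ?_⟩⟩
  · exact ⟨by linarith [ht.1, hx.1], by linarith [ht.2, hx.2]⟩
  · exact ⟨by linarith [hx.1], by linarith [hx.2]⟩

end IsCoercivePair

/-! ### Countable test for the existence of solutions -/

/-- The rational conditions that express that the primitive of `d` is an approximate solution. -/
def IsApproxSolution (a : ℝ → ℝ) (H : ℝ → ℝ → ℝ) (lam M x₀ σ c : ℝ) (n : ℕ) (d : ℝ → ℝ)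
    (r : ℝ) : Prop :=
  (∀ q : ℚ, |(q : ℝ)| < n + 1 → |primitive 0 d r q| ≤ M ∧
    |a q * d q + H q (primitive 0 d r q) - lam| ≤ 1 / ((n : ℝ) + 1)) ∧
  c - 1 / ((n : ℝ) + 1) ≤ σ * primitive 0 d r x₀

lemma exists_denseSeq_abs_sub_lt {f : ℝ → ℝ} (hf : Continuous f) (N : ℝ) {δ : ℝ} (hδ : 0 < δ) :
    ∃ j, ∀ x ∈ Icc (-N) N, |TopologicalSpace.denseSeq C(ℝ, ℝ) j x - f x| < δ := by
  have hopen : IsOpen {d : C(ℝ, ℝ) | MapsTo (d - (⟨f, hf⟩ : C(ℝ, ℝ))) (Icc (-N) N)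
      (Metric.ball 0 δ)} :=
    (ContinuousMap.isOpen_setOfPred_mapsTo isCompact_Icc Metric.isOpen_ball).preimage
      (continuous_id.sub continuous_const)
  obtain ⟨j, hj⟩ := (TopologicalSpace.denseRange_denseSeq C(ℝ, ℝ)).exists_mem_open hopen
    ⟨⟨f, hf⟩, fun x _ => by simpa using hδ⟩
  exact ⟨j, fun x hx => by simpa using hj hx⟩

namespace IsCoercivePair

variable {α₀ α₁ γ : ℝ} {a : ℝ → ℝ} {H : ℝ → ℝ → ℝ}

/-- Approximating `f'` and `f 0` controls `f` and the residual together; the converse is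
compactness. The cases `σ = 0, 1, -1` serve nonemptiness, the supremum and the infimum. -/
lemma exists_mem_iff_approx (hp : IsCoercivePair α₀ α₁ γ a H) (hpos : ∀ x, 0 < a x)
    {lam C σ : ℝ} (hC : IsCoercivityBound α₀ γ lam C) (hσ : |σ| ≤ 1) (x₀ c : ℝ) :
    (∃ f ∈ odeSolutions a H lam, c ≤ σ * f x₀) ↔ ∀ n : ℕ, ∃ (j : ℕ) (r : ℚ),
      IsApproxSolution a H lam (C + 1) x₀ σ c n (TopologicalSpace.denseSeq C(ℝ, ℝ) j) r := by
  constructor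
  · rintro ⟨f, hf, hfc⟩ n
    have hf' : Continuous (deriv f) := (contDiff_one_iff_deriv.1 hf.1).2
    have hfd := (contDiff_one_iff_deriv.1 hf.1).1
    set N : ℝ := n + 1 + |x₀| with hN
    set K := α₁ * (2 * (C + 1) + 1) ^ (γ - 1) with hK
    have hC1 := hC.1
    have hK0 : 0 ≤ K := by have := hp.α₁_pos; positivity
    set e : ℝ := 1 / ((n : ℝ) + 1) with he
    have hepos : 0 < e := by positivity
    have he1 : e ≤ 1 := by
      rw [he, div_le_one (by positivity)]; linarith [n.cast_nonneg (α := ℝ)]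
    set η := e / (1 + K) with hη
    have hηpos : 0 < η := by positivity
    have hηe : η * (1 + K) = e := by rw [hη]; field_simp
    have hηle : η ≤ e := by nlinarith
    -- Errors `δ` in `f'` and `f 0` integrate to at most `δ * (1 + N) = η` in `f`, and the residual
    -- is then at most `δ + K * η ≤ e`.
    set δ := η / (1 + N) with hδ
    have hN0 : 0 ≤ N := by positivity
    have hδpos : 0 < δ := by positivity
    have hδN : δ * (1 + N) = η := by rw [hδ]; field_simp
    have hδη : δ ≤ η := by nlinarith
    obtain ⟨j, hj⟩ := exists_denseSeq_abs_sub_lt hf' N hδpos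
    set d := TopologicalSpace.denseSeq C(ℝ, ℝ) j
    obtain ⟨r, hr1, hr2⟩ := exists_rat_btwn (show f 0 < f 0 + δ by linarith)
    have hclose : ∀ x ∈ Icc (-N) N, |primitive 0 d r x - f x| ≤ η := by
      intro x hx
      have h1 := (convex_Icc (-N) N).norm_image_sub_le_of_norm_hasDerivWithin_le
        (f := fun x => primitive 0 d r x - f x) (f' := fun x => d x - deriv f x) (C := δ)
        (fun t _ => ((hasDerivAt_primitive d.continuous 0 r t).sub
          (hfd t).hasDerivAt).hasDerivWithinAt)
        (fun t ht => (hj t ht).le) (x := 0) ⟨by linarith, hN0⟩ hx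
      rw [primitive_self, Real.norm_eq_abs, Real.norm_eq_abs, sub_zero] at h1
      have h2 : |x| ≤ N := abs_le.2 hx
      have h3 : |(r : ℝ) - f 0| ≤ δ := by rw [abs_of_pos (by linarith)]; linarith
      have h4 := abs_add_le (primitive 0 d r x - f x - (r - f 0)) (r - f 0)
      rw [sub_add_cancel] at h4
      have h5 : δ * |x| ≤ δ * N := by gcongr
      linarith
    refine ⟨j, r, fun q hq => ?_, ?_⟩
    · have hqN : (q : ℝ) ∈ Icc (-N) N := abs_le.1 (by linarith [abs_nonneg x₀])
      have h1 := hclose q hqN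
      have h2 := hp.abs_le_of_mem hC hf q
      have h3 : |primitive 0 d r q| ≤ C + 1 := by
        have := abs_add_le (primitive 0 d r q - f q) (f q)
        rw [sub_add_cancel] at this
        linarith
      refine ⟨h3, ?_⟩
      have h4 := hp.lipschitzOnWith (x := q) h3 (show |f q| ≤ C + 1 by linarith)
      have h5 : a q * d q + H q (primitive 0 d r q) - lam
          = a q * (d q - deriv f q) + (H q (primitive 0 d r q) - H q (f q)) := by
        rw [← hf.2 q]; ring
      have h6 : |a q * (d q - deriv f q)| ≤ δ := by
        rw [abs_mul, abs_of_nonneg (hp.nonneg q)]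
        have := hp.le_one q
        have h7 := (hj q hqN).le
        calc a q * |d q - deriv f q| ≤ 1 * δ := by gcongr
          _ = δ := one_mul δ
      rw [h5]
      refine (abs_add_le _ _).trans ?_
      have h7 : K * |primitive 0 d r q - f q| ≤ K * η := by gcongr
      linarith
    · have h1 := hclose x₀ (abs_le.1 (by linarith [n.cast_nonneg (α := ℝ)]))
      have h2 : |σ * (primitive 0 d r x₀ - f x₀)| ≤ η := by
        rw [abs_mul]
        calc |σ| * |primitive 0 d r x₀ - f x₀| ≤ 1 * η := by gcongr
          _ = η := one_mul η
      have h3 := (abs_le.1 h2).1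
      rw [mul_sub] at h3
      linarith
  · intro h
    refine hp.exists_mem_of_approx hpos (M := C + 1) fun n => ?_
    obtain ⟨j, r, h1, h2⟩ := h n
    set d := TopologicalSpace.denseSeq C(ℝ, ℝ) j
    refine ⟨primitive 0 d r, differentiable_primitive d.continuous 0 r, fun x hx => ?_, h2⟩
    rw [deriv_primitive d.continuous]
    have hpc : Continuous (primitive 0 d r) := (differentiable_primitive d.continuous 0 r).continuous
    have hclosed : IsClosed {x : ℝ | |primitive 0 d r x| ≤ C + 1 ∧
        |a x * d x + H x (primitive 0 d r x) - lam| ≤ 1 / ((n : ℝ) + 1)} := by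
      have h3 : Continuous fun x => H x (primitive 0 d r x) :=
        hp.continuous_H.comp (continuous_id.prodMk hpc)
      have h4 := (((hp.continuous_a.mul d.continuous).add h3).sub (continuous_const (y := lam))).abs
      exact (isClosed_le hpc.abs continuous_const).inter (isClosed_le h4 continuous_const)
    -- The rational test runs over an open interval of radius `n + 1`, so its closure covers the end
    -- points of `[-n, n]`.
    have hx' : x ∈ Ioo (-((n : ℝ) + 1)) (n + 1) := ⟨by linarith [hx.1], by linarith [hx.2]⟩
    have hcl := (Rat.denseRange_cast (𝕜 := ℝ)).open_subset_closure_inter isOpen_Ioo hx'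
    refine closure_minimal ?_ hclosed hcl
    rintro _ ⟨hy, q, rfl⟩
    exact h1 q (abs_lt.2 hy)

/-! ### The critical value -/

lemma isViscositySupersolution_of_mem (hp : IsCoercivePair α₀ α₁ γ a H) {lam : ℝ} {f : ℝ → ℝ}
    (hf : f ∈ odeSolutions a H lam) : IsViscositySupersolution a H lam (primitive 0 f 0) := by
  refine isViscositySupersolution_of_contDiff hp.nonneg (contDiff_two_primitive hf.1 0 0)
    fun x => ?_
  rw [deriv_primitive hf.1.continuous]
  exact (hf.2 x).le

lemma exists_supersolution (hp : IsCoercivePair α₀ α₁ γ a H) :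
    ∃ u, IsViscositySupersolution a H α₁ u := by
  refine ⟨fun _ => 0, isViscositySupersolution_of_contDiff hp.nonneg contDiff_const fun x => ?_⟩
  have := hp.upper x 0
  rw [abs_zero, Real.zero_rpow (by linarith [hp.two_lt])] at this
  simpa using this

/-- Below `-1 / α₀` solutions have slope at most `-δ`; over a long interval they would drop by more
than `2 * C`. This bounds below the set whose `sInf` is the critical value. -/
lemma neg_one_div_le_of_supersolution (hp : IsCoercivePair α₀ α₁ γ a H) (hpos : ∀ x, 0 < a x)
    {mu : ℝ} {u : ℝ → ℝ} (hu : IsViscositySupersolution a H mu u) : -(1 / α₀) ≤ mu := by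
  by_contra! hlt
  obtain ⟨lam, h1, h2⟩ := exists_between hlt
  obtain ⟨C, hC⟩ := exists_isCoercivityBound hp.α₀_pos hp.two_lt lam
  have hC1 := hC.1
  set δ := -(1 / α₀) - lam with hδ
  have hδpos : 0 < δ := by linarith
  obtain ⟨R, hR⟩ : ∃ R, R = (C + 1) / δ := ⟨_, rfl⟩
  have hRpos : 0 < R := by rw [hR]; positivity
  obtain ⟨g, hg, hgR⟩ := hp.exists_bounded_solution_on hpos hu h1 hC hRpos.le
  have hmv := (convex_Icc (-R) R).image_sub_le_mul_sub_of_deriv_le hg.continuous.continuousOn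
    hg.differentiableOn (C := -δ) (fun x hx => by
      have h3 := (hgR x (interior_subset hx)).2
      have h4 := hp.neg_one_div_le x (g x)
      have h5 : a x * deriv g x ≤ -δ := by linarith
      have h6 : deriv g x < 0 := by
        by_contra! h
        have := mul_nonneg (hp.nonneg x) h
        linarith
      nlinarith [hp.le_one x]) (-R) ⟨le_rfl, by linarith⟩ R ⟨by linarith, le_rfl⟩ (by linarith)
  have h3 := abs_le.1 (hgR R ⟨by linarith, le_rfl⟩).1
  have h4 := abs_le.1 (hgR (-R) ⟨le_rfl, by linarith⟩).1
  have h5 : δ * R = C + 1 := by rw [hR]; field_simp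
  nlinarith [h3.1, h4.2]

lemma criticalValue_le_iff (hp : IsCoercivePair α₀ α₁ γ a H) (hpos : ∀ x, 0 < a x) {lam : ℝ} :
    criticalValue a H ≤ lam ↔ (odeSolutions a H lam).Nonempty := by
  constructor
  · intro h
    obtain ⟨C, hC⟩ := exists_isCoercivityBound hp.α₀_pos hp.two_lt (lam + 1)
    -- Level `lam + 1 / (n + 1)` is solved on `[-n, n]`, all with the bound `C` for `lam + 1`; `σ =
    -- c = 0` makes the side condition void.
    obtain ⟨f, hf, -⟩ := hp.exists_mem_of_approx hpos (lam := lam) (M := C) (x₀ := 0) (σ := 0)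
      (c := 0) fun n => by
        have he : 0 < 1 / ((n : ℝ) + 1) := by positivity
        have he1 : 1 / ((n : ℝ) + 1) ≤ 1 := by
          rw [div_le_one (by positivity)]; linarith [n.cast_nonneg (α := ℝ)]
        obtain ⟨mu, ⟨u, hu⟩, hmu⟩ := exists_lt_of_csInf_lt ⟨α₁, hp.exists_supersolution⟩
          (show sInf {lam : ℝ | ∃ u, IsViscositySupersolution a H lam u}
            < lam + 1 / ((n : ℝ) + 1) from h.trans_lt (by linarith))
        obtain ⟨g, hg, hgn⟩ := hp.exists_bounded_solution_on hpos hu hmu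
          (hC.anti (by linarith)) n.cast_nonneg
        refine ⟨g, hg, fun x hx => ⟨(hgn x hx).1, ?_⟩, by simpa using he.le⟩
        rw [(hgn x hx).2, add_sub_cancel_left, abs_of_pos he]
    exact ⟨f, hf⟩
  · rintro ⟨f, hf⟩
    exact csInf_le ⟨-(1 / α₀), fun mu ⟨u, hu⟩ => hp.neg_one_div_le_of_supersolution hpos hu⟩
      ⟨_, hp.isViscositySupersolution_of_mem hf⟩

/-! ### Extremal solutions -/

lemma bddAbove_values (hp : IsCoercivePair α₀ α₁ γ a H) (lam σ x : ℝ) :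
    BddAbove ((fun f : ℝ → ℝ => σ * f x) '' odeSolutions a H lam) := by
  obtain ⟨C, hC⟩ := exists_isCoercivityBound hp.α₀_pos hp.two_lt lam
  refine ⟨|σ| * C, ?_⟩
  rintro _ ⟨f, hf, rfl⟩
  refine (le_abs_self _).trans ?_
  simp only [abs_mul]
  gcongr
  exact hp.abs_le_of_mem hC hf x

lemma exists_forall_le (hp : IsCoercivePair α₀ α₁ γ a H) (hpos : ∀ x, 0 < a x) {lam : ℝ}
    (hne : (odeSolutions a H lam).Nonempty) (σ x : ℝ) :
    ∃ f ∈ odeSolutions a H lam, ∀ g ∈ odeSolutions a H lam, σ * g x ≤ σ * f x := by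
  obtain ⟨C, hC⟩ := exists_isCoercivityBound hp.α₀_pos hp.two_lt lam
  have hb := hp.bddAbove_values lam σ x
  set s := sSup ((fun f : ℝ → ℝ => σ * f x) '' odeSolutions a H lam)
  obtain ⟨f, hf, hfs⟩ := hp.exists_mem_of_approx hpos (lam := lam) (M := C) (x₀ := x) (σ := σ)
      (c := s) fun n => by
        have he : 0 < 1 / ((n : ℝ) + 1) := by positivity
        obtain ⟨_, ⟨g, hg, rfl⟩, hgs⟩ := exists_lt_of_lt_csSup (hne.image _)
          (show s - 1 / ((n : ℝ) + 1) < s by linarith)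
        refine ⟨g, hg.1.differentiable one_ne_zero, fun y _ => ⟨hp.abs_le_of_mem hC hg y, ?_⟩,
          hgs.le⟩
        rw [hg.2 y, sub_self, abs_zero]
        exact he.le
  exact ⟨f, hf, fun g hg => (le_csSup hb ⟨g, hg, rfl⟩).trans hfs⟩

/-- A solution that is maximal at `0` is maximal everywhere, by non-crossing. -/
lemma isGreatest_sSup (hp : IsCoercivePair α₀ α₁ γ a H) (hpos : ∀ x, 0 < a x) {lam : ℝ}
    (hne : (odeSolutions a H lam).Nonempty) :
    IsGreatest (odeSolutions a H lam)
      (fun x => sSup ((fun f : ℝ → ℝ => f x) '' odeSolutions a H lam)) := by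
  obtain ⟨f, hf, hfle⟩ := hp.exists_forall_le hpos hne 1 0
  have hle : ∀ g ∈ odeSolutions a H lam, g ≤ f := fun g hg =>
    hp.le_of_le hpos hg hf (by simpa using hfle g hg)
  have heq : (fun x => sSup ((fun f : ℝ → ℝ => f x) '' odeSolutions a H lam)) = f :=
    funext fun x => IsGreatest.csSup_eq ⟨⟨f, hf, rfl⟩, by rintro _ ⟨g, hg, rfl⟩; exact hle g hg x⟩
  rw [heq]
  exact ⟨hf, hle⟩

lemma isLeast_sInf (hp : IsCoercivePair α₀ α₁ γ a H) (hpos : ∀ x, 0 < a x) {lam : ℝ}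
    (hne : (odeSolutions a H lam).Nonempty) :
    IsLeast (odeSolutions a H lam)
      (fun x => sInf ((fun f : ℝ → ℝ => f x) '' odeSolutions a H lam)) := by
  obtain ⟨f, hf, hfle⟩ := hp.exists_forall_le hpos hne (-1) 0
  have hle : ∀ g ∈ odeSolutions a H lam, f ≤ g := fun g hg =>
    hp.le_of_le hpos hf hg (by simpa using hfle g hg)
  have heq : (fun x => sInf ((fun f : ℝ → ℝ => f x) '' odeSolutions a H lam)) = f :=
    funext fun x => IsLeast.csInf_eq ⟨⟨f, hf, rfl⟩, by rintro _ ⟨g, hg, rfl⟩; exact hle g hg x⟩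
  rw [heq]
  exact ⟨hf, hle⟩

/-- Positivity of `a` and existence of solutions are not needed, so this holds for every `ω`,
exceptional ones included. -/
lemma lowerSemicontinuous_sSup (hp : IsCoercivePair α₀ α₁ γ a H) (lam : ℝ) :
    LowerSemicontinuous fun x => sSup ((fun f : ℝ → ℝ => f x) '' odeSolutions a H lam) := by
  have hb : ∀ x, BddAbove (range fun f : odeSolutions a H lam => f.1 x) := fun x => by
    have := hp.bddAbove_values lam 1 x
    simpa [image_eq_range] using this
  have := lowerSemicontinuous_ciSup hb fun f => f.2.1.continuous.lowerSemicontinuous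
  simpa [iSup, image_eq_range] using this

lemma lowerSemicontinuous_neg_sInf (hp : IsCoercivePair α₀ α₁ γ a H) (lam : ℝ) :
    LowerSemicontinuous fun x => -sInf ((fun f : ℝ → ℝ => f x) '' odeSolutions a H lam) := by
  have hb : ∀ x, BddAbove (range fun f : odeSolutions a H lam => -f.1 x) := fun x => by
    have := hp.bddAbove_values lam (-1) x
    simpa [image_eq_range] using this
  have := lowerSemicontinuous_ciSup hb fun f => f.2.1.continuous.neg.lowerSemicontinuous
  have heq : (fun x => -sInf ((fun f : ℝ → ℝ => f x) '' odeSolutions a H lam))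
      = fun x => ⨆ f : odeSolutions a H lam, -f.1 x := by
    funext x
    rw [Real.sInf_def, neg_neg, iSup, image_eq_range]
    congr 1
    ext y
    simp [neg_eq_iff_eq_neg]
  rw [heq]
  exact this

end IsCoercivePair

/-! ### Translation invariance -/

section Shift

lemma comp_add_mem_odeSolutions {a : ℝ → ℝ} {H : ℝ → ℝ → ℝ} {lam : ℝ} {f : ℝ → ℝ}
    (hf : f ∈ odeSolutions a H lam) (y : ℝ) :
    (fun x => f (x + y)) ∈ odeSolutions (fun x => a (x + y)) (fun x p => H (x + y) p) lam :=
  ⟨hf.1.comp (contDiff_id.add contDiff_const), fun x => by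
    rw [deriv_comp_add_const]; exact hf.2 (x + y)⟩

lemma image_odeSolutions_comp_add (a : ℝ → ℝ) (H : ℝ → ℝ → ℝ) (lam x y : ℝ) :
    (fun f : ℝ → ℝ => f x) '' odeSolutions (fun x => a (x + y)) (fun x p => H (x + y) p) lam
      = (fun f : ℝ → ℝ => f (x + y)) '' odeSolutions a H lam := by
  ext v
  constructor
  · rintro ⟨f, hf, rfl⟩
    refine ⟨fun z => f (z + -y), ?_, by simp⟩
    simpa using comp_add_mem_odeSolutions hf (-y)
  · rintro ⟨f, hf, rfl⟩
    exact ⟨fun z => f (z + y), comp_add_mem_odeSolutions hf y, rfl⟩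

lemma IsViscositySupersolution.comp_add {a : ℝ → ℝ} {H : ℝ → ℝ → ℝ} {lam : ℝ} {u : ℝ → ℝ}
    (hu : IsViscositySupersolution a H lam u) (y : ℝ) :
    IsViscositySupersolution (fun x => a (x + y)) (fun x p => H (x + y) p) lam
      (fun x => u (x + y)) := by
  refine ⟨hu.1.comp (by fun_prop), fun φ x₀ hφ hmin => ?_⟩
  have hd1 : deriv (fun x => φ (x - y)) = fun x => deriv φ (x - y) :=
    funext fun x => deriv_comp_sub_const φ y x
  have hd2 : deriv (fun x => deriv φ (x - y)) (x₀ + y) = deriv (deriv φ) x₀ := by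
    rw [deriv_comp_sub_const, add_sub_cancel_right]
  have h := hu.2 (fun x => φ (x - y)) (x₀ + y) (hφ.comp (contDiff_id.sub contDiff_const)) ?_
  · rw [hd1, hd2] at h
    simpa using h
  · have ht : Tendsto (fun x => x - y) (𝓝 (x₀ + y)) (𝓝 x₀) := by
      have : Continuous fun x : ℝ => x - y := by fun_prop
      simpa using this.tendsto (x₀ + y)
    have := ht.eventually hmin
    simpa [IsLocalMin, IsMinFilter] using this

lemma criticalValue_comp_add (a : ℝ → ℝ) (H : ℝ → ℝ → ℝ) (y : ℝ) :
    criticalValue (fun x => a (x + y)) (fun x p => H (x + y) p) = criticalValue a H := by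
  unfold criticalValue
  congr 1
  ext lam
  constructor
  · rintro ⟨u, hu⟩
    exact ⟨_, by simpa using hu.comp_add (-y)⟩
  · rintro ⟨u, hu⟩
    exact ⟨_, hu.comp_add y⟩

end Shift

/-! ### Measurability in `ω` and joint measurability -/

section Measurability

variable {Ω : Type*} [MeasurableSpace Ω]

/-- Over a complete measure space, a function which is measurable in `ω`, lower semicontinuous in
`x`, and continuous in `x` for almost every `ω` is jointly measurable. -/
lemma measurable_of_lowerSemicontinuous_of_ae_continuous {P : Measure Ω} [P.IsComplete]
    {F : ℝ → Ω → ℝ} (hl : ∀ ω, LowerSemicontinuous fun x => F x ω)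
    (hc : ∀ᵐ ω ∂P, Continuous fun x => F x ω) (hm : ∀ x, Measurable (F x)) :
    Measurable fun q : ℝ × Ω => F q.1 q.2 := by
  refine measurable_of_Ioi fun c => ?_
  -- Lower semicontinuity at every `ω` makes this equality exact: a null set of `ω` could not be
  -- discarded in the product `σ`-algebra, which need not be complete.
  have hset : (fun q : ℝ × Ω => F q.1 q.2) ⁻¹' Ioi c = ⋃ (s : ℚ) (t : ℚ) (k : ℕ),
      Ioo (s : ℝ) t ×ˢ {ω | ∀ x ∈ Ioo (s : ℝ) t, c + 1 / ((k : ℝ) + 1) ≤ F x ω} := by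
    ext ⟨x, ω⟩
    simp only [mem_preimage, mem_Ioi, mem_iUnion, mem_prod, mem_ofPred_eq]
    constructor
    · intro h
      obtain ⟨k, hk⟩ := exists_nat_one_div_lt (sub_pos.2 h)
      have hev := hl ω x (c + 1 / ((k : ℝ) + 1)) (by linarith)
      obtain ⟨l, u, hlu, hsub⟩ := mem_nhds_iff_exists_Ioo_subset.1 hev
      obtain ⟨s, hs1, hs2⟩ := exists_rat_btwn hlu.1
      obtain ⟨t, ht1, ht2⟩ := exists_rat_btwn hlu.2
      exact ⟨s, t, k, ⟨hs2, ht1⟩, fun y hy =>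
        (show c + 1 / ((k : ℝ) + 1) < F y ω from
          hsub ⟨hs1.trans hy.1, hy.2.trans ht2⟩).le⟩
    · rintro ⟨s, t, k, hx, h⟩
      have := h x hx
      have : 0 < 1 / ((k : ℝ) + 1) := by positivity
      linarith
  rw [hset]
  refine MeasurableSet.iUnion fun s => MeasurableSet.iUnion fun t => MeasurableSet.iUnion fun k =>
    measurableSet_Ioo.prod ?_
  set b := c + 1 / ((k : ℝ) + 1)
  have hrat : MeasurableSet {ω | ∀ q : ℚ, (q : ℝ) ∈ Ioo (s : ℝ) t → b ≤ F q ω} := by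
    simp only [ofPred_forall]
    exact MeasurableSet.iInter fun q => MeasurableSet.iInter fun _ =>
      measurableSet_le measurable_const (hm q)
  -- For continuous sections rational points suffice; the other `ω` form a null set, absorbed by
  -- completeness of `P`.
  refine (hrat.nullMeasurableSet (μ := P).congr ?_).measurable_of_complete
  refine eventuallyEq_set.2 ?_
  filter_upwards [hc] with ω hω
  refine ⟨fun h x hx => ?_, fun h q hq => h q hq⟩
  refine closure_minimal ?_ (isClosed_le (continuous_const (y := b)) hω)
    ((Rat.denseRange_cast (𝕜 := ℝ)).open_subset_closure_inter isOpen_Ioo hx)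
  rintro _ ⟨hy, q, rfl⟩
  exact h q hy

variable {P : Measure Ω} {τ : ℝ → Ω → Ω} {κ α₀ α₁ γ : ℝ} {a : ℝ → Ω → ℝ} {H : ℝ → ℝ → Ω → ℝ}

lemma isCoercivePair_of_isHamiltonian (hκ : 0 < κ) (ha : IsDiffusion P τ κ a) (hα₀ : 0 < α₀)
    (hα₁ : 0 < α₁) (hγ : 2 < γ) (hH : IsHamiltonian τ α₀ α₁ γ H) (ω : Ω) :
    IsCoercivePair α₀ α₁ γ (fun x => a x ω) (fun x p => H x p ω) where
  α₀_pos := hα₀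
  α₁_pos := hα₁
  two_lt := hγ
  continuous_a := by
    have h : Continuous fun x => √(a x ω) :=
      (LipschitzWith.of_dist_le_mul (K := κ.toNNReal) fun x y => by
        rw [Real.dist_eq, Real.dist_eq, Real.coe_toNNReal _ hκ.le]
        exact ha.sqrt_lipschitz ω x y).continuous
    simpa only [Real.sq_sqrt (ha.mem_Icc _ ω).1] using! h.fun_pow 2
  nonneg x := (ha.mem_Icc x ω).1
  le_one x := (ha.mem_Icc x ω).2
  continuous_H := by
    refine continuous_iff_continuousAt.2 fun ⟨x, p⟩ => ?_
    have hb : Continuous fun q : ℝ × ℝ => α₁ * (|q.2| + |p| + 1) ^ (γ - 1) * |q.2 - p|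
        + α₁ * (|p| ^ γ + 1) * |q.1 - x| := by
      have : Continuous fun q : ℝ × ℝ => (|q.2| + |p| + 1) ^ (γ - 1) :=
        Continuous.rpow_const (by fun_prop) fun _ => Or.inr (by linarith)
      fun_prop
    refine tendsto_iff_dist_tendsto_zero.2 (squeeze_zero (fun _ => dist_nonneg) (fun q => ?_)
      (by simpa using hb.tendsto (x, p)))
    rw [Real.dist_eq]
    have h1 := hH.lipschitz_p q.1 q.2 p ω
    have h2 := hH.lipschitz_x q.1 x p ω
    exact (abs_sub_le _ (H q.1 p ω) _).trans (add_le_add h1 h2)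
  lower x p := hH.lower x p ω
  upper x p := hH.upper x p ω
  lipschitz_p x p q := hH.lipschitz_p x p q ω

/-- The candidates do not depend on `ω`, which enters only through `a` and `H` at fixed arguments.
-/
lemma measurableSet_exists_isApproxSolution (ha : Measurable fun q : ℝ × Ω => a q.1 q.2)
    (hH : Measurable fun q : ℝ × ℝ × Ω => H q.1 q.2.1 q.2.2) (lam M x₀ σ c : ℝ) :
    MeasurableSet {ω | ∀ n : ℕ, ∃ (j : ℕ) (r : ℚ),
      IsApproxSolution (fun x => a x ω) (fun x p => H x p ω) lam M x₀ σ c n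
        (TopologicalSpace.denseSeq C(ℝ, ℝ) j) r} := by
  simp only [ofPred_forall, ofPred_exists]
  refine MeasurableSet.iInter fun n => MeasurableSet.iUnion fun j => MeasurableSet.iUnion fun r =>
    ?_
  have h1 : ∀ q : ℚ, Measurable fun ω => a q ω := fun q => ha.comp measurable_prodMk_left
  have h2 : ∀ (q : ℚ) (p : ℝ), Measurable fun ω => H q p ω := fun q p =>
    hH.comp (measurable_const.prodMk (measurable_const.prodMk measurable_id))
  have h3 : ∀ q : ℚ, MeasurableSet {ω | |a q ω * TopologicalSpace.denseSeq C(ℝ, ℝ) j q +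
      H q (primitive 0 (TopologicalSpace.denseSeq C(ℝ, ℝ) j) r q) ω - lam| ≤ 1 / ((n : ℝ) + 1)} :=
    fun q => measurableSet_le ((((h1 q).mul_const _).add (h2 q _)).sub_const lam).abs
      measurable_const
  simp only [IsApproxSolution, ofPred_and, ofPred_forall]
  exact (MeasurableSet.iInter fun q => MeasurableSet.iInter fun _ =>
    (MeasurableSet.const _).inter (h3 q)).inter (MeasurableSet.const _)

lemma measurableSet_exists_mem_odeSolutions [P.IsComplete] (hκ : 0 < κ) (ha : IsDiffusion P τ κ a)
    (hα₀ : 0 < α₀) (hα₁ : 0 < α₁) (hγ : 2 < γ) (hH : IsHamiltonian τ α₀ α₁ γ H)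
    {σ : ℝ} (hσ : |σ| ≤ 1) (lam x₀ c : ℝ) :
    MeasurableSet {ω | ∃ f ∈ odeSolutions (fun x => a x ω) (fun x p => H x p ω) lam,
      c ≤ σ * f x₀} := by
  obtain ⟨C, hC⟩ := exists_isCoercivityBound hα₀ hγ lam
  have hm := measurableSet_exists_isApproxSolution ha.stationary.measurable hH.measurable
    lam (C + 1) x₀ σ c
  refine (hm.nullMeasurableSet (μ := P).congr (eventuallyEq_set.2 ?_)).measurable_of_complete
  filter_upwards [ha.pos] with ω hω
  exact ((isCoercivePair_of_isHamiltonian hκ ha hα₀ hα₁ hγ hH ω).exists_mem_iff_approx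
    hω hC hσ x₀ c).symm

lemma measurable_criticalValue [P.IsComplete] (hκ : 0 < κ) (ha : IsDiffusion P τ κ a)
    (hα₀ : 0 < α₀) (hα₁ : 0 < α₁) (hγ : 2 < γ) (hH : IsHamiltonian τ α₀ α₁ γ H) :
    Measurable fun ω => criticalValue (fun x => a x ω) (fun x p => H x p ω) := by
  refine measurable_of_Iic fun lam => ?_
  have hm := measurableSet_exists_mem_odeSolutions hκ ha hα₀ hα₁ hγ hH (σ := 0) (by simp) lam 0 0
  refine (hm.nullMeasurableSet (μ := P).congr (eventuallyEq_set.2 ?_)).measurable_of_complete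
  filter_upwards [ha.pos] with ω hω
  rw [mem_preimage, mem_Iic, (isCoercivePair_of_isHamiltonian hκ ha hα₀ hα₁ hγ hH
    ω).criticalValue_le_iff hω]
  simp [Set.Nonempty]

lemma measurable_upperSolution [P.IsComplete] (hκ : 0 < κ) (ha : IsDiffusion P τ κ a)
    (hα₀ : 0 < α₀) (hα₁ : 0 < α₁) (hγ : 2 < γ) (hH : IsHamiltonian τ α₀ α₁ γ H) {lam : ℝ}
    (hne : ∀ᵐ ω ∂P, (odeSolutions (fun x => a x ω) (fun x p => H x p ω) lam).Nonempty) :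
    Measurable fun q : ℝ × Ω => upperSolution a H lam q.1 q.2 := by
  have hp := isCoercivePair_of_isHamiltonian hκ ha hα₀ hα₁ hγ hH
  refine measurable_of_lowerSemicontinuous_of_ae_continuous (P := P)
    (fun ω => (hp ω).lowerSemicontinuous_sSup lam) ?_ fun x => ?_
  · filter_upwards [hne, ha.pos] with ω h1 h2
    exact ((hp ω).isGreatest_sSup h2 h1).1.1.continuous
  · refine measurable_of_Ici fun c => ?_
    have hm := measurableSet_exists_mem_odeSolutions hκ ha hα₀ hα₁ hγ hH (σ := 1) (by simp) lam x c
    refine (hm.nullMeasurableSet (μ := P).congr (eventuallyEq_set.2 ?_)).measurable_of_complete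
    filter_upwards [hne, ha.pos] with ω h1 h2
    have hg := (hp ω).isGreatest_sSup h2 h1
    simp only [one_mul, mem_preimage, mem_Ici]
    exact ⟨fun ⟨f, hf, hc⟩ => hc.trans (hg.2 hf x), fun h => ⟨_, hg.1, h⟩⟩

lemma measurable_lowerSolution [P.IsComplete] (hκ : 0 < κ) (ha : IsDiffusion P τ κ a)
    (hα₀ : 0 < α₀) (hα₁ : 0 < α₁) (hγ : 2 < γ) (hH : IsHamiltonian τ α₀ α₁ γ H) {lam : ℝ}
    (hne : ∀ᵐ ω ∂P, (odeSolutions (fun x => a x ω) (fun x p => H x p ω) lam).Nonempty) :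
    Measurable fun q : ℝ × Ω => lowerSolution a H lam q.1 q.2 := by
  have hp := isCoercivePair_of_isHamiltonian hκ ha hα₀ hα₁ hγ hH
  suffices h : Measurable fun q : ℝ × Ω => -lowerSolution a H lam q.1 q.2 by
    simpa using! h.fun_neg
  refine measurable_of_lowerSemicontinuous_of_ae_continuous (P := P)
    (F := fun x ω => -lowerSolution a H lam x ω)
    (fun ω => (hp ω).lowerSemicontinuous_neg_sInf lam) ?_ fun x => ?_
  · filter_upwards [hne, ha.pos] with ω h1 h2
    exact ((hp ω).isLeast_sInf h2 h1).1.1.continuous.neg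
  · refine measurable_of_Ici fun c => ?_
    have hm := measurableSet_exists_mem_odeSolutions hκ ha hα₀ hα₁ hγ hH (σ := -1) (by simp) lam x c
    refine (hm.nullMeasurableSet (μ := P).congr (eventuallyEq_set.2 ?_)).measurable_of_complete
    filter_upwards [hne, ha.pos] with ω h1 h2
    have hg := (hp ω).isLeast_sInf h2 h1
    simp only [neg_one_mul, mem_preimage, mem_Ici]
    exact ⟨fun ⟨f, hf, hc⟩ => hc.trans (neg_le_neg (hg.2 hf x)), fun h => ⟨_, hg.1, h⟩⟩

end Measurability

/-! ### The main result -/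

theorem lemma3p6 {Ω : Type*} [TopologicalSpace Ω] [PolishSpace Ω] [MeasurableSpace Ω]
    (P : Measure Ω) [IsProbabilityMeasure P] (hP : IsCompletedBorel P)
    (τ : ℝ → Ω → Ω) (hτ : IsErgodicFlow P τ)
    (κ : ℝ) (hκ : 0 < κ) (a : ℝ → Ω → ℝ) (ha : IsDiffusion P τ κ a)
    (α₀ α₁ γ : ℝ) (hα₀ : 0 < α₀) (hα₁ : 0 < α₁) (hγ : 2 < γ)
    (H : ℝ → ℝ → Ω → ℝ) (hH : IsHamiltonian τ α₀ α₁ γ H) :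
    ∃ lam₀ : ℝ,
      (∀ᵐ ω ∂P, criticalValue (fun x => a x ω) (fun x p => H x p ω) = lam₀) ∧
      ∀ lam : ℝ, lam₀ ≤ lam →
        IsStationaryFun τ (lowerSolution a H lam) ∧
        IsStationaryFun τ (upperSolution a H lam) ∧
        (∀ ω, (∀ x, 0 < a x ω) →
          criticalValue (fun x => a x ω) (fun x p => H x p ω) ≤ lam →
            IsLeast (odeSolutions (fun x => a x ω) (fun x p => H x p ω) lam)
              (fun x => lowerSolution a H lam x ω) ∧
            IsGreatest (odeSolutions (fun x => a x ω) (fun x p => H x p ω) lam)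
              (fun x => upperSolution a H lam x ω)) ∧
        (∀ᵐ ω ∂P,
          (fun x => lowerSolution a H lam x ω) ∈
            odeSolutions (fun x => a x ω) (fun x p => H x p ω) lam ∧
          (fun x => upperSolution a H lam x ω) ∈
            odeSolutions (fun x => a x ω) (fun x p => H x p ω) lam) := by
  have := hP.complete
  have hp := isCoercivePair_of_isHamiltonian hκ ha hα₀ hα₁ hγ hH
  have ha_shift : ∀ y ω, (fun x => a x (τ y ω)) = fun x => a (x + y) ω := fun y ω =>
    funext fun x => (ha.stationary.shift x y ω).symm
  have hH_shift : ∀ y ω, (fun x p => H x p (τ y ω)) = fun x p => H (x + y) p ω := fun y ω =>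
    funext fun x => funext fun p => (hH.shift x y p ω).symm
  obtain ⟨lam₀, hlam₀⟩ := hτ.ergodic _ (measurable_criticalValue hκ ha hα₀ hα₁ hγ hH)
    fun y => Eventually.of_forall fun ω => by
      simp only [ha_shift, hH_shift]
      exact criticalValue_comp_add (fun x => a x ω) (fun x p => H x p ω) y
  refine ⟨lam₀, hlam₀, fun lam hlam => ?_⟩
  have hne : ∀ᵐ ω ∂P, (odeSolutions (fun x => a x ω) (fun x p => H x p ω) lam).Nonempty := by
    filter_upwards [hlam₀, ha.pos] with ω h1 h2
    exact ((hp ω).criticalValue_le_iff h2).1 (h1.trans_le hlam)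
  refine ⟨⟨measurable_lowerSolution hκ ha hα₀ hα₁ hγ hH hne, fun x y ω => ?_⟩,
    ⟨measurable_upperSolution hκ ha hα₀ hα₁ hγ hH hne, fun x y ω => ?_⟩, fun ω h1 h2 => ?_, ?_⟩
  · rw [lowerSolution, lowerSolution, ha_shift, hH_shift,
      image_odeSolutions_comp_add (fun x => a x ω) (fun x p => H x p ω)]
  · rw [upperSolution, upperSolution, ha_shift, hH_shift,
      image_odeSolutions_comp_add (fun x => a x ω) (fun x p => H x p ω)]
  · have h3 := ((hp ω).criticalValue_le_iff h1).1 h2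
    exact ⟨(hp ω).isLeast_sInf h1 h3, (hp ω).isGreatest_sSup h1 h3⟩
  · filter_upwards [hne, ha.pos] with ω h1 h2
    exact ⟨((hp ω).isLeast_sInf h2 h1).1, ((hp ω).isGreatest_sSup h2 h1).1⟩
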